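/- Let $n\ge 1$ and let $E\subset\mathbb{R}^n$ be a bounded set with smooth boundary: every $p\in\partial E$ has an open neighbourhood $U$ with a function $\varphi\in C^\infty(U)$ such that $\nabla\varphi\neq0$ on $U$, $(\partial E)\cap U=\{x\in U:\varphi(x)=0\}$, $\{x\in U:\varphi(x)<0\}\subset E$ and $\{x\in U:\varphi(x)>0\}\subset E^c$. For disjoint sets $S_1,S_2\subset\mathbb{R}^n$ and $s\in(0,\tfrac12)$ put $$I_s(S_1,S_2):=\iint_{S_1\times S_2}\frac{dx\,dy}{|x-y|^{n+2s}}\in[0,\infty],$$ and, for $\Omega\subset\mathbb{R}^n$, $$\mathrm{Per}_s(E,\Omega):=I_s(E\cap\Omega,E^c\cap\Omega)+I_s(E\cap\Omega,E^c\setminus\Omega)+I_s(E\setminus\Omega,E^c\cap\Omega),$$ so that $\mathrm{Per}_s(E,\mathbb{R}^n)=I_s(E,E^c)$. Let $\mathrm{Per}(E,\mathbb{R}^n):=\mathcal{H}^{n-1}(\partial E)$ be the classical perimeter, where $\mathcal{H}^{d}$ is the Hausdorff measure normalized to agree with Lebesgue measure on $\mathbb{R}^d$, and let $\kappa_{m}$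 be the $m$-dimensional volume of the unit ball of $\mathbb{R}^m$ (so $\kappa_0=1$). Then $\mathrm{Per}(E,\mathbb{R}^n)<\infty$ and $$\lim_{s\nearrow 1/2}(1-2s)\,\mathrm{Per}_s(E,\mathbb{R}^n)=\kappa_{n-1}\,\mathrm{Per}(E,\mathbb{R}^n).$$ -/

import Mathlib

open MeasureTheory Filter Topology Set
open scoped ENNReal ContDiff

/-- `E` has smooth boundary: near each of its boundary points, `E` is, up to points of the boundary
itself, the sublevel set `{φ < 0}` of a `C^∞` function `φ` whose differential does not vanish.
(So the boundary is locally `{φ = 0}`, and `E` lies locally on exactly one side of it; no choice is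
made as to which boundary points belong to `E`.) -/
def HasSmoothBoundary {n : ℕ} (E : Set (EuclideanSpace ℝ (Fin n))) : Prop :=
  ∀ p ∈ frontier E, ∃ U : Set (EuclideanSpace ℝ (Fin n)), IsOpen U ∧ p ∈ U ∧
    ∃ φ : EuclideanSpace ℝ (Fin n) → ℝ, ContDiffOn ℝ ∞ φ U ∧
      (∀ x ∈ U, fderiv ℝ φ x ≠ 0) ∧
      (∀ x ∈ U, φ x = 0 ↔ x ∈ frontier E) ∧
      (∀ x ∈ U, φ x < 0 → x ∈ E) ∧
      (∀ x ∈ U, 0 < φ x → x ∉ E)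

/-- The interaction `I(S, T) = ∬_{S × T} dx dy / |x - y|^(n + 2s)`, with values in `[0, ∞]`. -/
noncomputable def interaction {n : ℕ} (s : ℝ) (S T : Set (EuclideanSpace ℝ (Fin n))) : ℝ≥0∞ :=
  ∫⁻ z in S ×ˢ T, 1 / ‖z.1 - z.2‖ₑ ^ ((n : ℝ) + 2 * s)

/-- The fractional perimeter `Per_s(E, Ω)`. -/
noncomputable def fracPerimeter {n : ℕ} (s : ℝ) (E Ω : Set (EuclideanSpace ℝ (Fin n))) : ℝ≥0∞ :=
  interaction s (E ∩ Ω) (Eᶜ ∩ Ω) + interaction s (E ∩ Ω) (Eᶜ \ Ω) + interaction s (E \ Ω) (Eᶜ ∩ Ω)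

/-- The classical perimeter `Per(E, Ω) = H^(n-1)(∂E ∩ Ω)` of a set with smooth boundary. The
Hausdorff measure is normalized so that `H^d` is the Lebesgue measure on `ℝ^d`. -/
noncomputable def classicalPerimeter {n : ℕ} (E Ω : Set (EuclideanSpace ℝ (Fin n))) : ℝ≥0∞ :=
  Measure.euclideanHausdorffMeasure (n - 1) (frontier E ∩ Ω)

/-- The `m`-dimensional volume of the unit ball of `ℝ^m`. -/
noncomputable def unitBallVolume (m : ℕ) : ℝ≥0∞ :=
  volume (Metric.ball (0 : EuclideanSpace ℝ (Fin m)) 1)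

/-! With `O = interior E` and `g h = volume {x | x ∈ O ∧ x + h ∉ O}`, substituting `y = x + h` turns
the fractional perimeter into the integral of `g h / ‖h‖ ^ (n + 2s)`. After multiplication by `1 -
2s` this kernel concentrates at the origin as `s ↗ 1/2`, so only the first-order behaviour of `g` at
`0` survives. A translation by `h` pushes a boundary piece with unit normal `ν` and area `a` out of
`O` through a volume of about `a (ν·h)₊`, and the integral of `(ν·θ)₊` over the unit sphere is
`κ_{n-1}` for every `ν`. Adding up the pieces gives `κ_{n-1}` times the area of the boundary.

This is made rigorous without an area formula or a Gauss–Green theorem.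
`exists_graph_of_hasStrictFDerivAt` presents the boundary locally as a graph with Lipschitz constant
as small as desired. `exists_lintegral_crossing_near` computes the crossing volume of one localized
piece, and `exists_approx_crossing` adds the pieces with a finite partition of unity: `g h` is `∑ aᵢ
(νᵢ·h)₊` up to a small multiple of `‖h‖`, with `∑ aᵢ` close to the area.
`tendsto_mul_lintegral_kernel` turns such approximations into the limit. -/

/-! ### Orthogonal coordinates and radial integration -/

theorem exists_orthonormalBasis_zero_eq {Z : Type*} [NormedAddCommGroup Z] [InnerProductSpace ℝ Z]
    [FiniteDimensional ℝ Z] {d : ℕ} (hZ : Module.finrank ℝ Z = d + 1) {w : Z} (hw : ‖w‖ = 1) :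
    ∃ b : OrthonormalBasis (Fin (d + 1)) ℝ Z, b 0 = w := by
  obtain ⟨b, hb⟩ := Orthonormal.exists_orthonormalBasis_extension_of_card_eq (𝕜 := ℝ)
    (ι := Fin (d + 1)) (by simpa using hZ) (v := fun _ => w) (s := {0}) (by
      constructor
      · intro i; simpa using hw
      · intro i j hij; exact absurd (Subsingleton.elim i j) hij)
  exact ⟨b, hb 0 rfl⟩

theorem exists_linearIsometryEquiv_map_eq {X Y : Type*} [NormedAddCommGroup X] [InnerProductSpace ℝ X]
    [NormedAddCommGroup Y] [InnerProductSpace ℝ Y] [FiniteDimensional ℝ X] [FiniteDimensional ℝ Y]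
    {d : ℕ} (hX : Module.finrank ℝ X = d + 1) (hY : Module.finrank ℝ Y = d + 1)
    {u : X} {v : Y} (hu : ‖u‖ = 1) (hv : ‖v‖ = 1) : ∃ R : X ≃ₗᵢ[ℝ] Y, R u = v := by
  obtain ⟨b, hb⟩ := exists_orthonormalBasis_zero_eq hX hu
  obtain ⟨c, hc⟩ := exists_orthonormalBasis_zero_eq hY hv
  refine ⟨b.equiv c (Equiv.refl _), ?_⟩
  rw [← hb, OrthonormalBasis.equiv_apply_basis]; simpa using hc

/-- The isometry lives on the `L²` product. It is transported to the plain product so that Tonelli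
applies; as that product carries the sup norm, the Euclidean norm is recorded by its square. -/
theorem exists_adapted_coordinates {m : ℕ} {ν : EuclideanSpace ℝ (Fin (m + 1))} (hν : ‖ν‖ = 1) :
    ∃ M : (EuclideanSpace ℝ (Fin m) × ℝ) ≃L[ℝ] EuclideanSpace ℝ (Fin (m + 1)),
      MeasurePreserving M volume volume ∧ (∀ z, ‖M z‖ ^ 2 = ‖z.1‖ ^ 2 + z.2 ^ 2) ∧
      ∀ z, inner ℝ ν (M z) = z.2 := by
  have hd : Module.finrank ℝ (WithLp 2 (EuclideanSpace ℝ (Fin m) × ℝ)) = m + 1 := by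
    rw [(WithLp.linearEquiv 2 ℝ _).finrank_eq]; simp
  obtain ⟨R, hR⟩ := exists_linearIsometryEquiv_map_eq (d := m) hd (by simp)
    (u := WithLp.toLp 2 ((0 : EuclideanSpace ℝ (Fin m)), (1 : ℝ))) (v := ν)
    (by simp) hν
  refine ⟨(WithLp.prodContinuousLinearEquiv 2 ℝ _ _).symm.trans R.toContinuousLinearEquiv, ?_, ?_, ?_⟩
  · exact R.measurePreserving.comp (WithLp.volume_preserving_toLp _ _)
  · intro z
    have : ‖R (WithLp.toLp 2 z)‖ ^ 2 = ‖z.1‖ ^ 2 + z.2 ^ 2 := by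
      rw [R.norm_map, WithLp.prod_norm_sq_eq_of_L2]; simp
    exact this
  · intro z
    have : inner ℝ ν (R (WithLp.toLp 2 z)) = z.2 := by
      rw [← hR, R.inner_map_map, WithLp.prod_inner_apply]; simp
    exact this

/-- Polar coordinates: the Jacobian contributes `r ^ m`, and homogeneity of degree one contributes
another factor `r`. -/
theorem lintegral_mul_fun_norm {m : ℕ} {w : EuclideanSpace ℝ (Fin (m + 1)) → ℝ≥0∞}
    (hw : Measurable w) (hhom : ∀ (r : ℝ) x, 0 < r → w (r • x) = ENNReal.ofReal r * w x)
    {φ : ℝ → ℝ≥0∞} (hφ : Measurable φ) :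
    ∫⁻ h, w h * φ ‖h‖ = (∫⁻ θ : Metric.sphere (0 : EuclideanSpace ℝ (Fin (m + 1))) 1, w θ ∂(volume : Measure (EuclideanSpace ℝ (Fin (m + 1)))).toSphere) *
      ∫⁻ r in Ioi (0 : ℝ), ENNReal.ofReal (r ^ (m + 1)) * φ r := by
  have hmp := (volume : Measure (EuclideanSpace ℝ (Fin (m + 1)))).measurePreserving_homeomorphUnitSphereProd
  have hd : Module.finrank ℝ (EuclideanSpace ℝ (Fin (m + 1))) - 1 = m := by simp
  rw [hd] at hmp
  calc ∫⁻ h, w h * φ ‖h‖ = ∫⁻ h in ({0}ᶜ : Set (EuclideanSpace ℝ (Fin (m + 1)))), w h * φ ‖h‖ := by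
        rw [restrict_compl_singleton]
    _ = ∫⁻ h : ({0}ᶜ : Set (EuclideanSpace ℝ (Fin (m + 1)))), w h * φ ‖h.1‖ ∂(volume.comap Subtype.val) := by
        rw [lintegral_subtype_comap (measurableSet_singleton _).compl fun x ↦ w x * φ ‖x‖]
    _ = ∫⁻ z : Metric.sphere (0 : EuclideanSpace ℝ (Fin (m + 1))) 1 × Ioi (0 : ℝ),
          w z.1 * (ENNReal.ofReal z.2 * φ z.2)
          ∂(volume : Measure (EuclideanSpace ℝ (Fin (m + 1)))).toSphere.prod (Measure.volumeIoiPow m) := by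
        rw [← hmp.lintegral_comp_emb (Homeomorph.measurableEmbedding _)]
        refine lintegral_congr fun h => ?_
        have hpos : 0 < ‖h.1‖ := norm_pos_iff.2 h.2
        have : w h.1 = ENNReal.ofReal ‖h.1‖ * w (‖h.1‖⁻¹ • h.1) := by
          rw [← hhom _ _ hpos, smul_smul, mul_inv_cancel₀ hpos.ne', one_smul]
        simp only [homeomorphUnitSphereProd_apply_snd_coe, homeomorphUnitSphereProd_apply_fst_coe]
        rw [this]; ring
    _ = (∫⁻ θ : Metric.sphere (0 : EuclideanSpace ℝ (Fin (m + 1))) 1, w θ ∂(volume : Measure (EuclideanSpace ℝ (Fin (m + 1)))).toSphere) *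
          ∫⁻ r, (ENNReal.ofReal (r : Ioi (0 : ℝ)) * φ r) ∂(Measure.volumeIoiPow m) := by
        rw [lintegral_prod_mul (f := fun θ : Metric.sphere (0 : EuclideanSpace ℝ (Fin (m + 1))) 1 => w θ)
          (g := fun r : Ioi (0 : ℝ) => ENNReal.ofReal r * φ r)]
        · exact (hw.comp measurable_subtype_coe).aemeasurable
        · exact ((ENNReal.measurable_ofReal.mul hφ).comp measurable_subtype_coe).aemeasurable
    _ = _ := by
        congr 1
        rw [Measure.volumeIoiPow, lintegral_withDensity_eq_lintegral_mul,
          ← lintegral_subtype_comap measurableSet_Ioi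
            fun r ↦ ENNReal.ofReal (r ^ (m + 1)) * φ r]
        · refine lintegral_congr fun r => ?_
          have : (0 : ℝ) ≤ r ^ m := pow_nonneg (le_of_lt r.2) _
          simp only [Pi.mul_apply]
          rw [pow_succ, ENNReal.ofReal_mul this, mul_assoc]
        · fun_prop
        · exact ((ENNReal.measurable_ofReal.mul hφ).comp measurable_subtype_coe)

theorem lintegral_ball_eq_sphere {m : ℕ} {w : EuclideanSpace ℝ (Fin (m + 1)) → ℝ≥0∞}
    (hw : Measurable w) (hhom : ∀ (r : ℝ) x, 0 < r → w (r • x) = ENNReal.ofReal r * w x) :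
    ∫⁻ h in Metric.ball 0 1, w h = (∫⁻ θ : Metric.sphere (0 : EuclideanSpace ℝ (Fin (m + 1))) 1, w θ
      ∂(volume : Measure (EuclideanSpace ℝ (Fin (m + 1)))).toSphere) *
      ENNReal.ofReal (1 / (m + 2)) := by
  have hm : Measurable ((Iio (1 : ℝ)).indicator (fun _ => (1 : ℝ≥0∞))) :=
    measurable_const.indicator measurableSet_Iio
  have h1 := lintegral_mul_fun_norm hw hhom hm
  rw [← lintegral_indicator Metric.isOpen_ball.measurableSet]
  convert h1 using 1
  · refine lintegral_congr fun h => ?_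
    by_cases hh : ‖h‖ < 1 <;> simp [indicator, hh]
  · congr 1
    have : ∀ r : ℝ, ENNReal.ofReal (r ^ (m + 1)) * (Iio (1 : ℝ)).indicator (fun _ => 1) r =
        (Iio (1 : ℝ)).indicator (fun r => ENNReal.ofReal (r ^ (m + 1))) r := by
      intro r; by_cases hr : r < 1 <;> simp [indicator, hr]
    simp_rw [this]
    rw [setLIntegral_indicator measurableSet_Iio, inter_comm, Ioi_inter_Iio,
      ← ofReal_integral_eq_lintegral_ofReal, ← integral_Ioc_eq_integral_Ioo,
      ← intervalIntegral.integral_of_le zero_le_one, integral_pow]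
    · congr 1; push_cast; simp; ring
    · exact ((continuous_pow (m + 1)).integrableOn_Icc (a := 0) (b := 1)).mono_set Ioo_subset_Icc_self
    · filter_upwards [ae_restrict_mem measurableSet_Ioo] with y hy
      exact pow_nonneg hy.1.le _

theorem lintegral_ball_mul_kernel {m : ℕ} {w : EuclideanSpace ℝ (Fin (m + 1)) → ℝ≥0∞}
    (hw : Measurable w) (hhom : ∀ (r : ℝ) x, 0 < r → w (r • x) = ENNReal.ofReal r * w x)
    {s δ : ℝ} (hs : s < 1 / 2) (hδ : 0 < δ) :
    ∫⁻ h in Metric.ball 0 δ, w h * (1 / ‖h‖ₑ ^ (((m + 1 : ℕ) : ℝ) + 2 * s)) =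
      (∫⁻ θ : Metric.sphere (0 : EuclideanSpace ℝ (Fin (m + 1))) 1, w θ
      ∂(volume : Measure (EuclideanSpace ℝ (Fin (m + 1)))).toSphere) *
      ENNReal.ofReal (δ ^ (1 - 2 * s) / (1 - 2 * s)) := by
  have hm : Measurable ((Iio δ).indicator
      (fun r => 1 / ENNReal.ofReal r ^ (((m + 1 : ℕ) : ℝ) + 2 * s))) :=
    Measurable.indicator (by fun_prop) measurableSet_Iio
  have h1 := lintegral_mul_fun_norm hw hhom hm
  rw [← lintegral_indicator Metric.isOpen_ball.measurableSet]
  convert h1 using 1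
  · refine lintegral_congr fun h => ?_
    by_cases hh : ‖h‖ < δ <;> simp [indicator, hh]
  · congr 1
    have : ∀ r ∈ Ioi (0 : ℝ), ENNReal.ofReal (r ^ (m + 1)) * (Iio δ).indicator
        (fun r => 1 / ENNReal.ofReal r ^ (((m + 1 : ℕ) : ℝ) + 2 * s)) r =
        (Iio δ).indicator (fun r => ENNReal.ofReal (r ^ (-(2 * s)))) r := by
      intro r hr
      by_cases hrδ : r < δ
      · simp only [indicator, mem_Iio, hrδ, if_true]
        have hr' : (0 : ℝ) < r := hr
        rw [ENNReal.ofReal_rpow_of_pos hr', one_div, ← ENNReal.ofReal_inv_of_pos (by positivity),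
          ← ENNReal.ofReal_mul (by positivity), ← Real.rpow_natCast r (m + 1),
          ← Real.rpow_neg hr'.le, ← Real.rpow_add hr']
        congr 2; ring
      · simp [indicator, hrδ]
    rw [setLIntegral_congr_fun measurableSet_Ioi this,
      setLIntegral_indicator measurableSet_Iio, inter_comm, Ioi_inter_Iio,
      ← ofReal_integral_eq_lintegral_ofReal, ← integral_Ioc_eq_integral_Ioo,
      ← intervalIntegral.integral_of_le hδ.le, integral_rpow (Or.inl (by linarith))]
    · rw [Real.zero_rpow (by linarith)]; congr 1; rw [sub_zero]; ring_nf
    · exact ((intervalIntegrable_iff_integrableOn_Ioc_of_le hδ.le).1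
        (intervalIntegral.intervalIntegrable_rpow' (by linarith))).mono_set Ioo_subset_Ioc_self
    · filter_upwards [ae_restrict_mem measurableSet_Ioo] with y hy
      exact Real.rpow_nonneg hy.1.le _

theorem integral_mul_sqrt_pow (m : ℕ) :
    ∫ t in (0 : ℝ)..1, t * √(1 - t ^ 2) ^ m = 1 / (m + 2) := by
  have := intervalIntegral.integral_eq_sub_of_hasDerivAt_of_le (a := 0) (b := 1) zero_le_one
    (f := fun t => - √(1 - t ^ 2) ^ (m + 2) / (m + 2)) (f' := fun t => t * √(1 - t ^ 2) ^ m)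
    (by fun_prop) (by
      intro t ht
      have h0 : 0 < 1 - t ^ 2 := by nlinarith [ht.1, ht.2]
      have h1 : HasDerivAt (fun t : ℝ => 1 - t ^ 2) (-(2 * t)) t := by
        simpa using (hasDerivAt_pow 2 t).const_sub 1
      have h2 := ((h1.sqrt h0.ne').pow (m + 2)).neg.div_const ((m : ℝ) + 2)
      refine h2.congr_deriv ?_
      have hs : √(1 - t ^ 2) ≠ 0 := (Real.sqrt_pos.2 h0).ne'
      have : (m : ℝ) + 2 ≠ 0 := by positivity
      have e : m + 2 - 1 = m + 1 := rfl
      rw [e, pow_succ]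
      push_cast
      field_simp)
    (by apply Continuous.intervalIntegrable; fun_prop)
  rw [this]
  simp [neg_div]

/-- The sphere integral is read off from a ball integral. The slice of the unit ball at height `t`
along `ν` is an `m`-ball of radius `√(1 - t²)`, so slicing gives `κ_m / (m + 2)`, while polar
coordinates give the sphere integral times the same `1 / (m + 2)`. -/
theorem lintegral_sphere_inner {m : ℕ} {ν : EuclideanSpace ℝ (Fin (m + 1))} (hν : ‖ν‖ = 1) :
    ∫⁻ θ : Metric.sphere (0 : EuclideanSpace ℝ (Fin (m + 1))) 1, ENNReal.ofReal (inner ℝ ν θ.1)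
      ∂(volume : Measure (EuclideanSpace ℝ (Fin (m + 1)))).toSphere = unitBallVolume m := by
  obtain ⟨M, hM, hnorm, hinner⟩ := exists_adapted_coordinates hν
  have hw : Measurable fun h : EuclideanSpace ℝ (Fin (m + 1)) => ENNReal.ofReal (inner ℝ ν h) := by
    fun_prop
  have h1 := lintegral_ball_eq_sphere hw (by
    intro r x hr
    rw [inner_smul_right, ENNReal.ofReal_mul hr.le])
  have h2 : ∫⁻ h in Metric.ball 0 1, ENNReal.ofReal (inner ℝ ν h) =
      unitBallVolume m * ENNReal.ofReal (1 / (m + 2)) := by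
    rw [← lintegral_indicator Metric.isOpen_ball.measurableSet, ← hM.lintegral_comp
      (hw.indicator Metric.isOpen_ball.measurableSet), Measure.volume_eq_prod,
      lintegral_prod_symm' (fun z => (Metric.ball 0 1).indicator
        (fun h => ENNReal.ofReal (inner ℝ ν h)) (M z)) ((hw.indicator Metric.isOpen_ball.measurableSet).comp
        M.continuous.measurable)]
    have : ∀ t : ℝ, ∫⁻ x : EuclideanSpace ℝ (Fin m), (Metric.ball 0 1).indicator
        (fun h => ENNReal.ofReal (inner ℝ ν h)) (M (x, t)) =
        (Ioo (0 : ℝ) 1).indicator (fun t => unitBallVolume m * ENNReal.ofReal (t * √(1 - t ^ 2) ^ m)) t := by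
      intro t
      have hind : ∀ x : EuclideanSpace ℝ (Fin m), (Metric.ball 0 1).indicator
        (fun h => ENNReal.ofReal (inner ℝ ν h)) (M (x, t)) =
          (Metric.ball 0 (√(1 - t ^ 2))).indicator (fun _ => ENNReal.ofReal t) x := by
        intro x
        have hiff : M (x, t) ∈ Metric.ball (0 : EuclideanSpace ℝ (Fin (m + 1))) 1 ↔
            x ∈ Metric.ball (0 : EuclideanSpace ℝ (Fin m)) (√(1 - t ^ 2)) := by
          rw [mem_ball_zero_iff, mem_ball_zero_iff, Real.lt_sqrt (norm_nonneg _),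
            ← sq_lt_one_iff₀ (norm_nonneg _), hnorm, lt_sub_iff_add_lt]
        by_cases hx : x ∈ Metric.ball (0 : EuclideanSpace ℝ (Fin m)) (√(1 - t ^ 2))
        · rw [indicator_of_mem (hiff.2 hx), indicator_of_mem hx, hinner]
        · rw [indicator_of_notMem (fun h => hx (hiff.1 h)), indicator_of_notMem hx]
      simp_rw [hind]
      rw [lintegral_indicator Metric.isOpen_ball.measurableSet, setLIntegral_const]
      by_cases ht : t ∈ Ioo (0 : ℝ) 1
      · rw [indicator_of_mem ht, Measure.addHaar_ball_of_pos _ _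
          (Real.sqrt_pos.2 (by nlinarith [ht.1, ht.2])),
          ENNReal.ofReal_mul ht.1.le, finrank_euclideanSpace_fin, unitBallVolume]
        ring
      · rw [indicator_of_notMem ht]
        rw [mem_Ioo, not_and_or] at ht
        rcases ht with ht | ht
        · rw [ENNReal.ofReal_of_nonpos (by linarith), zero_mul]
        -- An open ball of radius `0` is empty, also when `m = 0`.
        · rw [Real.sqrt_eq_zero_of_nonpos (by nlinarith)]; simp
    simp_rw [this]
    rw [lintegral_indicator measurableSet_Ioo, lintegral_const_mul _ (by fun_prop),
      ← ofReal_integral_eq_lintegral_ofReal, ← integral_Ioc_eq_integral_Ioo,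
      ← intervalIntegral.integral_of_le zero_le_one, integral_mul_sqrt_pow]
    · exact (Continuous.integrableOn_Icc (a := 0) (b := 1) (by fun_prop)).mono_set Ioo_subset_Icc_self
    · filter_upwards [ae_restrict_mem measurableSet_Ioo] with y hy
      exact mul_nonneg hy.1.le (by positivity)
  rw [h2] at h1
  exact ((ENNReal.mul_left_inj (by simp; positivity) ENNReal.ofReal_ne_top).1 h1).symm

/-! ### Concentration of the kernel at the origin -/

theorem tendsto_mul_lintegral_ball {m : ℕ} {w : EuclideanSpace ℝ (Fin (m + 1)) → ℝ≥0∞}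
    (hw : Measurable w) (hhom : ∀ (r : ℝ) x, 0 < r → w (r • x) = ENNReal.ofReal r * w x)
    {c : ℝ≥0∞} (hc : c ≠ ⊤) (hcw : ∫⁻ θ : Metric.sphere (0 : EuclideanSpace ℝ (Fin (m + 1))) 1, w θ
      ∂(volume : Measure (EuclideanSpace ℝ (Fin (m + 1)))).toSphere = c) {δ : ℝ} (hδ : 0 < δ) :
    Tendsto (fun s : ℝ => ENNReal.ofReal (1 - 2 * s) *
      ∫⁻ h in Metric.ball 0 δ, w h * (1 / ‖h‖ₑ ^ (((m + 1 : ℕ) : ℝ) + 2 * s)))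
      (𝓝[<] (1 / 2 : ℝ)) (𝓝 c) := by
  have h1 : Tendsto (fun s : ℝ => c * ENNReal.ofReal (δ ^ (1 - 2 * s))) (𝓝[<] (1 / 2 : ℝ)) (𝓝 c) := by
    have h2 : Tendsto (fun s : ℝ => δ ^ (1 - 2 * s)) (𝓝[<] (1 / 2 : ℝ)) (𝓝 1) := by
      have : ContinuousAt (fun s : ℝ => δ ^ (1 - 2 * s)) (1 / 2) :=
        (Real.continuousAt_const_rpow hδ.ne').comp (by fun_prop)
      have h3 := this.tendsto.mono_left (nhdsWithin_le_nhds (s := Iio (1 / 2 : ℝ)))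
      simpa using h3
    simpa using ENNReal.Tendsto.const_mul (ENNReal.tendsto_ofReal h2) (Or.inr hc)
  refine h1.congr' ?_
  filter_upwards [self_mem_nhdsWithin] with s hs
  have hs' : (s : ℝ) < 1 / 2 := hs
  have hpos : 0 < 1 - 2 * s := by linarith
  rw [lintegral_ball_mul_kernel hw hhom hs' hδ, hcw, mul_left_comm, ← ENNReal.ofReal_mul hpos.le,
    mul_div_cancel₀ _ hpos.ne']

theorem tendsto_mul_lintegral_compl_ball (m : ℕ) {δ : ℝ} (hδ : 0 < δ) :
    Tendsto (fun s : ℝ => ENNReal.ofReal (1 - 2 * s) *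
      ∫⁻ h in (Metric.ball (0 : EuclideanSpace ℝ (Fin (m + 1))) δ)ᶜ,
        1 / ‖h‖ₑ ^ (((m + 1 : ℕ) : ℝ) + 2 * s))
      (𝓝[<] (1 / 2 : ℝ)) (𝓝 0) := by
  -- This `c` gives `c (1 + ‖h‖) ≤ ‖h‖` whenever `‖h‖ ≥ δ`. For `s` in `(1/4, 1/2)` the kernel is
  -- then dominated, uniformly in `s`, by a multiple of `(1 + ‖h‖) ^ (-(m + 3/2))`, which is
  -- integrable in dimension `m + 1`.
  set c : ℝ := δ / (1 + δ) with hc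
  have hc0 : 0 < c := by positivity
  have hc1 : c ≤ 1 := by rw [hc, div_le_one (by positivity)]; linarith
  set B : ℝ≥0∞ := ENNReal.ofReal (c ^ (-((m : ℝ) + 2))) *
    ∫⁻ h : EuclideanSpace ℝ (Fin (m + 1)), ENNReal.ofReal ((1 + ‖h‖) ^ (-((m : ℝ) + 3 / 2))) with hB
  have hBtop : B ≠ ⊤ := by
    refine ENNReal.mul_ne_top ENNReal.ofReal_ne_top (finite_integral_one_add_norm ?_).ne
    rw [finrank_euclideanSpace_fin]; push_cast; linarith
  have h1 : Tendsto (fun s : ℝ => ENNReal.ofReal (1 - 2 * s) * B) (𝓝[<] (1 / 2 : ℝ)) (𝓝 0) := by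
    have : ContinuousAt (fun s : ℝ => ENNReal.ofReal (1 - 2 * s)) (1 / 2) :=
      (ENNReal.continuous_ofReal.comp (by fun_prop)).continuousAt
    have h3 := this.tendsto.mono_left (nhdsWithin_le_nhds (s := Iio (1 / 2 : ℝ)))
    simpa using ENNReal.Tendsto.mul_const h3 (Or.inr hBtop)
  refine tendsto_of_tendsto_of_tendsto_of_le_of_le' tendsto_const_nhds h1
    (Eventually.of_forall fun _ => zero_le) ?_
  filter_upwards [Ioo_mem_nhdsLT (show (1 / 4 : ℝ) < 1 / 2 by norm_num)] with s hs
  refine mul_le_mul_right ?_ _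
  rw [hB, ← lintegral_const_mul _ (by fun_prop)]
  refine (setLIntegral_mono' (Metric.isOpen_ball.measurableSet.compl) (fun h hh => ?_)).trans
    (setLIntegral_le_lintegral _ _)
  have hh' : δ ≤ ‖h‖ := by simpa using hh
  have hpos : 0 < ‖h‖ := hδ.trans_le hh'
  have hle : c * (1 + ‖h‖) ≤ ‖h‖ := by
    rw [hc, div_mul_eq_mul_div, div_le_iff₀ (by positivity)]; nlinarith
  rw [← ofReal_norm, ENNReal.ofReal_rpow_of_pos hpos, one_div,
    ← ENNReal.ofReal_inv_of_pos (by positivity), ← ENNReal.ofReal_mul (by positivity),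
    ← Real.rpow_neg hpos.le]
  refine ENNReal.ofReal_le_ofReal ?_
  push_cast
  calc ‖h‖ ^ (-((m : ℝ) + 1 + 2 * s)) ≤ (c * (1 + ‖h‖)) ^ (-((m : ℝ) + 1 + 2 * s)) :=
        Real.rpow_le_rpow_of_nonpos (by positivity) hle (by linarith [hs.1])
    _ = c ^ (-((m : ℝ) + 1 + 2 * s)) * (1 + ‖h‖) ^ (-((m : ℝ) + 1 + 2 * s)) :=
        Real.mul_rpow hc0.le (by positivity)
    _ ≤ _ := by
        refine mul_le_mul (Real.rpow_le_rpow_of_exponent_ge hc0 hc1 (by linarith [hs.2]))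
          (Real.rpow_le_rpow_of_exponent_le (by linarith) (by linarith [hs.1])) (by positivity)
          (by positivity)

/-- Outside a ball the bound `A` makes the contribution vanish in the limit. Inside, the model `∑ aᵢ
(νᵢ·h)₊` contributes exactly `κ_m ∑ aᵢ`, and the error `ε ‖h‖` at most a constant times `ε`. Errors
are added to the larger side, since subtraction in `ℝ≥0∞` truncates. -/
theorem tendsto_mul_lintegral_kernel {m : ℕ} {g : EuclideanSpace ℝ (Fin (m + 1)) → ℝ≥0∞}
    {A P : ℝ≥0∞} (hA : A ≠ ⊤) (hgA : ∀ h, g h ≤ A) (hP : P ≠ ⊤)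
    (hyp : ∀ ε : ℝ≥0∞, ε ≠ 0 → ε ≠ ⊤ → ∃ (N : ℕ) (ν : Fin N → EuclideanSpace ℝ (Fin (m + 1)))
      (a : Fin N → ℝ≥0∞) (δ : ℝ), 0 < δ ∧ (∀ i, ‖ν i‖ = 1) ∧
      (∀ h, ‖h‖ < δ → g h ≤ ∑ i, a i * ENNReal.ofReal (inner ℝ (ν i) h) + ε * ‖h‖ₑ) ∧
      (∀ h, ‖h‖ < δ → ∑ i, a i * ENNReal.ofReal (inner ℝ (ν i) h) ≤ g h + ε * ‖h‖ₑ) ∧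
      ∑ i, a i ≤ P + ε ∧ P ≤ ∑ i, a i + ε) :
    Tendsto (fun s : ℝ => ENNReal.ofReal (1 - 2 * s) *
      ∫⁻ h, g h * (1 / ‖h‖ₑ ^ (((m + 1 : ℕ) : ℝ) + 2 * s)))
      (𝓝[<] (1 / 2 : ℝ)) (𝓝 (unitBallVolume m * P)) := by
  set κ := unitBallVolume m with hκ
  have hκtop : κ ≠ ⊤ := measure_ball_lt_top.ne
  set C : ℝ≥0∞ := (volume : Measure (EuclideanSpace ℝ (Fin (m + 1)))).toSphere univ with hC
  have hCtop : C ≠ ⊤ := measure_ne_top _ _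
  have hk : ∀ s : ℝ, Measurable fun h : EuclideanSpace ℝ (Fin (m + 1)) =>
      1 / ‖h‖ₑ ^ (((m + 1 : ℕ) : ℝ) + 2 * s) := fun s => by fun_prop
  have model : ∀ (N : ℕ) (ν : Fin N → EuclideanSpace ℝ (Fin (m + 1))) (a : Fin N → ℝ≥0∞) (ε : ℝ≥0∞)
      (δ : ℝ), 0 < δ → (∀ i, ‖ν i‖ = 1) → ∑ i, a i ≠ ⊤ → ε ≠ ⊤ →
      Tendsto (fun s : ℝ => ENNReal.ofReal (1 - 2 * s) *
        ∫⁻ h in Metric.ball 0 δ, (∑ i, a i * ENNReal.ofReal (inner ℝ (ν i) h) + ε * ‖h‖ₑ) *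
          (1 / ‖h‖ₑ ^ (((m + 1 : ℕ) : ℝ) + 2 * s)))
        (𝓝[<] (1 / 2 : ℝ)) (𝓝 (κ * ∑ i, a i + ε * C)) := by
    intro N ν a ε δ hδ hν ha hε
    refine tendsto_mul_lintegral_ball (by fun_prop) ?_ (by finiteness) ?_ hδ
    · intro r x hr
      rw [mul_add, Finset.mul_sum]
      congr 1
      · refine Finset.sum_congr rfl fun i _ => ?_
        rw [inner_smul_right, ENNReal.ofReal_mul hr.le]; ring
      · rw [enorm_smul, Real.enorm_of_nonneg hr.le]; ring
    · rw [lintegral_add_right _ (by fun_prop), lintegral_finsetSum _ (by fun_prop)]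
      congr 1
      · rw [Finset.mul_sum]
        refine Finset.sum_congr rfl fun i _ => ?_
        rw [lintegral_const_mul _ (by fun_prop), lintegral_sphere_inner (hν i), mul_comm]
      · rw [lintegral_const_mul _ (by fun_prop), hC]
        congr 1
        simp [← ofReal_norm]
  have eps : ∀ x y D : ℝ≥0∞, D ≠ ⊤ → (∀ ε : ℝ≥0∞, ε ≠ 0 → ε ≠ ⊤ → x ≤ y + ε * D) → x ≤ y := by
    intro x y D hD h
    have h1 : Tendsto (fun ε : ℝ≥0∞ => y + ε * D) (𝓝[>] 0) (𝓝 (y + 0 * D)) := by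
      refine tendsto_const_nhds.add (ENNReal.Tendsto.mul_const ?_ (Or.inr hD))
      exact tendsto_nhdsWithin_of_tendsto_nhds tendsto_id
    rw [zero_mul, add_zero] at h1
    refine ge_of_tendsto h1 ?_
    filter_upwards [self_mem_nhdsWithin, mem_nhdsWithin_of_mem_nhds
      (Iio_mem_nhds (show (0 : ℝ≥0∞) < 1 by simp))] with ε h1 h2
    exact h ε (ne_of_gt h1) (ne_top_of_lt h2)
  refine tendsto_of_le_liminf_of_limsup_le ?_ ?_
  · refine eps _ _ (κ + (C + 1)) (by finiteness) fun ε hε hεt => ?_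
    obtain ⟨N, ν, a, δ, hδ, hν, -, hlow, ha, haP⟩ := hyp ε hε hεt
    have hsum : ∑ i, a i ≠ ⊤ := ne_top_of_le_ne_top (by finiteness) ha
    have h1 := model N ν a 0 δ hδ hν hsum (by simp)
    -- The empty model with error coefficient `1` isolates the integral of `‖h‖`; its limit is `C`,
    -- so it is eventually below `C + 1`.
    have h2 := model 0 0 0 1 δ hδ (fun i => i.elim0) (by simp) (by simp)
    simp only [zero_mul, add_zero, Finset.univ_eq_empty, Finset.sum_empty, mul_zero, zero_add,
      one_mul] at h1 h2
    have h3 : κ * ∑ i, a i ≤ liminf (fun s : ℝ => ENNReal.ofReal (1 - 2 * s) *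
        ∫⁻ h, g h * (1 / ‖h‖ₑ ^ (((m + 1 : ℕ) : ℝ) + 2 * s))) (𝓝[<] (1 / 2 : ℝ)) + ε * (C + 1) := by
      rw [← liminf_add_const _ _ _ (by isBoundedDefault) (by isBoundedDefault), ← h1.liminf_eq]
      refine liminf_le_liminf ?_ (by isBoundedDefault) (by isBoundedDefault)
      have hlt : C < C + 1 := ENNReal.lt_add_right hCtop (by simp)
      filter_upwards [h2.eventually (gt_mem_nhds hlt)] with s hs
      calc _ ≤ ENNReal.ofReal (1 - 2 * s) * ∫⁻ h in Metric.ball 0 δ,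
            (g h * (1 / ‖h‖ₑ ^ (((m + 1 : ℕ) : ℝ) + 2 * s)) +
              ε * (‖h‖ₑ * (1 / ‖h‖ₑ ^ (((m + 1 : ℕ) : ℝ) + 2 * s)))) := by
            refine mul_le_mul_right ?_ _
            refine setLIntegral_mono' Metric.isOpen_ball.measurableSet fun h hh => ?_
            rw [← mul_assoc, ← add_mul]
            exact mul_le_mul_left (hlow h (by simpa using hh)) _
        _ = ENNReal.ofReal (1 - 2 * s) * (∫⁻ h in Metric.ball 0 δ,
            g h * (1 / ‖h‖ₑ ^ (((m + 1 : ℕ) : ℝ) + 2 * s))) + ε * (ENNReal.ofReal (1 - 2 * s) *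
            ∫⁻ h in Metric.ball (0 : EuclideanSpace ℝ (Fin (m + 1))) δ, ‖h‖ₑ * (1 / ‖h‖ₑ ^ (((m + 1 : ℕ) : ℝ) + 2 * s))) := by
            -- The integral is split using measurability of the error term alone; nothing is known
            -- about measurability of `g`.
            rw [lintegral_add_right _ (by fun_prop), lintegral_const_mul _ (by fun_prop)]; ring
        _ ≤ _ := by
            gcongr
            exact Measure.restrict_le_self
    calc κ * P ≤ κ * (∑ i, a i + ε) := by gcongr
      _ = κ * ∑ i, a i + ε * κ := by ring
      _ ≤ _ := by
        refine (add_le_add_left h3 _).trans (le_of_eq ?_)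
        ring
  · refine eps _ _ (κ + C) (by finiteness) fun ε hε hεt => ?_
    obtain ⟨N, ν, a, δ, hδ, hν, hup, -, ha, haP⟩ := hyp ε hε hεt
    have hsum : ∑ i, a i ≠ ⊤ := ne_top_of_le_ne_top (by finiteness) ha
    have h1 := (model N ν a ε δ hδ hν hsum hεt).add
      (ENNReal.Tendsto.const_mul (tendsto_mul_lintegral_compl_ball m hδ) (Or.inr hA))
    rw [mul_zero, add_zero] at h1
    have h3 : limsup (fun s : ℝ => ENNReal.ofReal (1 - 2 * s) *
        ∫⁻ h, g h * (1 / ‖h‖ₑ ^ (((m + 1 : ℕ) : ℝ) + 2 * s))) (𝓝[<] (1 / 2 : ℝ)) ≤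
        κ * ∑ i, a i + ε * C := by
      rw [← h1.limsup_eq]
      refine limsup_le_limsup (Eventually.of_forall fun s => ?_) (by isBoundedDefault)
        (by isBoundedDefault)
      dsimp only
      rw [← lintegral_add_compl _ (Metric.isOpen_ball (x := 0) (ε := δ)).measurableSet, mul_add,
        mul_left_comm A]
      refine add_le_add (mul_le_mul_right ?_ _) (mul_le_mul_right ?_ _)
      · refine setLIntegral_mono' Metric.isOpen_ball.measurableSet fun h hh => ?_
        exact mul_le_mul_left (hup h (by simpa using hh)) _
      · rw [← lintegral_const_mul _ (hk s)]
        exact lintegral_mono fun h => mul_le_mul_left (hgA h) _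
    calc _ ≤ _ := h3
      _ ≤ κ * (P + ε) + ε * C := by gcongr
      _ = _ := by ring

/-! ### The boundary as a graph of small Lipschitz constant -/

/-- `M` is an isometric, volume preserving identification of `ℝ^m × ℝ` with `ℝ^(m+1)` whose last
coordinate axis points in the direction `ν`. -/
structure IsAdapted {m : ℕ} (ν : EuclideanSpace ℝ (Fin (m + 1)))
    (M : (EuclideanSpace ℝ (Fin m) × ℝ) ≃L[ℝ] EuclideanSpace ℝ (Fin (m + 1))) : Prop where
  norm_eq_one : ‖ν‖ = 1
  measurePreserving : MeasurePreserving M volume volume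
  norm_sq : ∀ z, ‖M z‖ ^ 2 = ‖z.1‖ ^ 2 + z.2 ^ 2
  inner_apply : ∀ z, inner ℝ ν (M z) = z.2

namespace IsAdapted

variable {m : ℕ} {ν : EuclideanSpace ℝ (Fin (m + 1))}
  {M : (EuclideanSpace ℝ (Fin m) × ℝ) ≃L[ℝ] EuclideanSpace ℝ (Fin (m + 1))}

theorem norm_fst_le (hM : IsAdapted ν M) (z : EuclideanSpace ℝ (Fin m) × ℝ) : ‖z.1‖ ≤ ‖M z‖ := by
  refine (sq_le_sq₀ (by positivity) (norm_nonneg _)).1 ?_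
  rw [hM.norm_sq]; nlinarith [sq_nonneg z.2]

theorem abs_snd_le (hM : IsAdapted ν M) (z : EuclideanSpace ℝ (Fin m) × ℝ) : |z.2| ≤ ‖M z‖ := by
  refine (sq_le_sq₀ (by positivity) (norm_nonneg _)).1 ?_
  rw [hM.norm_sq, sq_abs]; nlinarith [sq_nonneg ‖z.1‖]

theorem norm_le_add (hM : IsAdapted ν M) (z : EuclideanSpace ℝ (Fin m) × ℝ) :
    ‖M z‖ ≤ ‖z.1‖ + |z.2| := by
  refine (sq_le_sq₀ (by positivity) (by positivity)).1 ?_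
  rw [hM.norm_sq]
  nlinarith [norm_nonneg z.1, abs_nonneg z.2, sq_abs z.2, mul_nonneg (norm_nonneg z.1) (abs_nonneg z.2)]

end IsAdapted

theorem exists_isAdapted {m : ℕ} {ν : EuclideanSpace ℝ (Fin (m + 1))} (hν : ‖ν‖ = 1) :
    ∃ M, IsAdapted ν M := by
  obtain ⟨M, h1, h2, h3⟩ := exists_adapted_coordinates hν
  exact ⟨M, hν, h1, h2, h3⟩

/-- In coordinates whose last axis is the gradient direction, strict differentiability says that
increments of `φ` are `a` times the height increment, up to a small error. Hence `φ` increases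
strictly in the height, has a zero on each nearby vertical line, and two zeros differ little in
height compared with their horizontal distance. -/
theorem exists_graph_of_hasStrictFDerivAt {m : ℕ} {φ : EuclideanSpace ℝ (Fin (m + 1)) → ℝ}
    {φ' : EuclideanSpace ℝ (Fin (m + 1)) →L[ℝ] ℝ} {p : EuclideanSpace ℝ (Fin (m + 1))}
    (hφ : HasStrictFDerivAt φ φ' p) (hφ' : φ' ≠ 0) (hp : φ p = 0) {ε : NNReal} (hε0 : 0 < ε)
    (hε1 : ε < 1) :
    ∃ ν M, IsAdapted ν M ∧ ∃ f : EuclideanSpace ℝ (Fin m) → ℝ, LipschitzWith ε f ∧ ∃ r > 0,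
      ∀ z, M z ∈ Metric.ball p r → (φ (M z) < 0 ↔ z.2 < f z.1) ∧ (φ (M z) = 0 ↔ z.2 = f z.1) := by
  set a := ‖φ'‖ with ha
  have ha0 : 0 < a := norm_pos_iff.2 hφ'
  set ν : EuclideanSpace ℝ (Fin (m + 1)) := a⁻¹ • (InnerProductSpace.toDual ℝ _).symm φ' with hνdef
  have hν : ‖ν‖ = 1 := by
    rw [hνdef, norm_smul, LinearIsometryEquiv.norm_map, norm_inv, Real.norm_of_nonneg ha0.le, ← ha,
      inv_mul_cancel₀ ha0.ne']
  have hφν : ∀ x, φ' x = a * inner ℝ ν x := by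
    intro x
    rw [hνdef, real_inner_smul_left, InnerProductSpace.toDual_symm_apply, mul_inv_cancel_left₀ ha0.ne']
  obtain ⟨M, hM⟩ := exists_isAdapted hν
  refine ⟨ν, M, hM, ?_⟩
  -- Two zeros satisfy `(1 - e) |Δt| ≤ e ‖Δx‖`, and `e / (1 - e) = ε` is the wanted Lipschitz
  -- constant. The consequence `2 * e < 1` of `ε < 1` forces the sign change in the intermediate
  -- value argument.
  set e : ℝ := ε / (1 + ε) with he
  have hεr0 : (0 : ℝ) < ε := hε0
  have hεr1 : (ε : ℝ) < 1 := hε1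
  have he0 : 0 < e := by positivity
  have he1 : 2 * e < 1 := by
    rw [he, ← mul_div_assoc, div_lt_one (by positivity)]; linarith
  have hee : ε * (1 - e) = e := by rw [he]; field_simp; ring
  obtain ⟨s, hs, happ⟩ := hφ.approximates_deriv_on_nhds (c := ⟨a * e, by positivity⟩)
    (Or.inr (show (0 : ℝ) < a * e by positivity))
  obtain ⟨ρ, hρ, hρs⟩ := Metric.mem_nhds_iff.1 hs
  have hdiff : ∀ z w, M z ∈ Metric.ball p ρ → M w ∈ Metric.ball p ρ →
      |φ (M z) - φ (M w) - a * (z.2 - w.2)| ≤ a * (e * (‖z.1 - w.1‖ + |z.2 - w.2|)) := by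
    intro z w hz hw
    have h1 := happ _ (hρs hz) _ (hρs hw)
    rw [← map_sub, hφν, hM.inner_apply] at h1
    refine h1.trans ?_
    have h2 := hM.norm_le_add (z - w)
    calc a * e * ‖M (z - w)‖ ≤ a * e * (‖(z - w).1‖ + |(z - w).2|) := by gcongr
      _ = _ := by rw [mul_assoc]; rfl
  set x₀ := (M.symm p).1 with hx₀
  set t₀ := (M.symm p).2 with ht₀
  have hMp : M (x₀, t₀) = p := M.apply_symm_apply p
  set c := ρ / 4 with hc
  have hc0 : 0 < c := by positivity
  have hmem : ∀ x t, ‖x - x₀‖ ≤ c → |t - t₀| ≤ c → M (x, t) ∈ Metric.ball p ρ := by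
    intro x t hx ht
    rw [mem_ball_iff_norm, ← hMp, ← map_sub]
    refine (hM.norm_le_add _).trans_lt ?_
    simp only [Prod.mk_sub_mk]
    linarith
  have hpm : M (x₀, t₀) ∈ Metric.ball p ρ := by rw [hMp]; exact Metric.mem_ball_self hρ
  have hmono : ∀ x t t', ‖x - x₀‖ ≤ c → |t - t₀| ≤ c → |t' - t₀| ≤ c → t < t' →
      φ (M (x, t)) < φ (M (x, t')) := by
    intro x t t' hx ht ht' htt
    have h1 := (abs_le.1 (hdiff (x, t') (x, t) (hmem _ _ hx ht') (hmem _ _ hx ht))).1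
    simp only [sub_self, norm_zero, zero_add] at h1
    rw [abs_of_pos (sub_pos.2 htt)] at h1
    have h3 : 0 < t' - t := sub_pos.2 htt
    have : 0 < a * ((1 - e) * (t' - t)) := by
      have : 0 < 1 - e := by linarith
      positivity
    nlinarith
  have hzero : ∀ x, ‖x - x₀‖ ≤ c → ∃ t, |t - t₀| ≤ c ∧ φ (M (x, t)) = 0 := by
    intro x hx
    have hcc : |c| = c := abs_of_pos hc0
    have h1 := (abs_le.1 (hdiff (x, t₀ + c) (x₀, t₀) (hmem _ _ hx (by simp [hcc])) hpm)).1
    have h2 := (abs_le.1 (hdiff (x, t₀ - c) (x₀, t₀) (hmem _ _ hx (by simp [hcc])) hpm)).2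
    have he2 : a * (e * (‖x - x₀‖ + c)) ≤ a * c := by
      have : e * (‖x - x₀‖ + c) ≤ e * (c + c) := by gcongr
      have h3 : e * (c + c) ≤ c := by nlinarith
      gcongr
      exact this.trans h3
    simp only [hMp, hp, add_sub_cancel_left, sub_sub_cancel_left, abs_neg, hcc, sub_zero] at h1 h2
    have hcont : ContinuousOn (fun t => φ (M (x, t))) (Icc (t₀ - c) (t₀ + c)) := by
      refine (happ.continuousOn.mono hρs).comp (by fun_prop) fun t ht => hmem _ _ hx ?_
      rw [abs_le]; constructor <;> linarith [ht.1, ht.2]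
    obtain ⟨t, ht, ht0⟩ := intermediate_value_Icc (by linarith) hcont
      (show (0 : ℝ) ∈ Icc _ _ from ⟨by linarith, by linarith⟩)
    exact ⟨t, by rw [abs_le]; constructor <;> linarith [ht.1, ht.2], ht0⟩
  choose! f₀ hf₀ hf₀z using hzero
  have hlip : LipschitzOnWith ε f₀ (Metric.closedBall x₀ c) := by
    refine LipschitzOnWith.of_dist_le_mul fun x hx y hy => ?_
    rw [mem_closedBall_iff_norm] at hx hy
    have h1 := hdiff (x, f₀ x) (y, f₀ y) (hmem _ _ hx (hf₀ x hx)) (hmem _ _ hy (hf₀ y hy))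
    rw [hf₀z x hx, hf₀z y hy, sub_self, zero_sub, abs_neg, abs_mul, abs_of_pos ha0] at h1
    have h2 := le_of_mul_le_mul_left h1 ha0
    simp only at h2
    rw [Real.dist_eq, dist_eq_norm]
    have h3 : (1 - e) * |f₀ x - f₀ y| ≤ (1 - e) * (ε * ‖x - y‖) := by
      have : (1 - e) * (ε * ‖x - y‖) = e * ‖x - y‖ := by linear_combination ‖x - y‖ * hee
      nlinarith
    exact le_of_mul_le_mul_left h3 (by linarith)
  -- Extending `f₀` to the whole plane makes later integrals over it free of domain conditions.
  obtain ⟨f, hf, hff⟩ := hlip.extend_real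
  refine ⟨f, hf, c, hc0, fun z hz => ?_⟩
  rw [mem_ball_iff_norm, ← hMp, ← map_sub] at hz
  have hz1 : ‖z.1 - x₀‖ ≤ c := ((hM.norm_fst_le _).trans_lt hz).le
  have hz2 : |z.2 - t₀| ≤ c := ((hM.abs_snd_le _).trans_lt hz).le
  rw [← hff (mem_closedBall_iff_norm.2 hz1)]
  have h0 := hf₀z _ hz1
  rcases lt_trichotomy z.2 (f₀ z.1) with h | h | h
  · have := hmono _ _ _ hz1 hz2 (hf₀ _ hz1) h
    rw [h0, Prod.mk.eta] at this
    simp [h, this, this.ne, h.ne]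
  · have : M z = M (z.1, f₀ z.1) := by rw [← h]
    rw [this, h0]; simp [h]
  · have := hmono _ _ _ hz1 (hf₀ _ hz1) hz2 h
    rw [h0, Prod.mk.eta] at this
    simp [this.ne', h.ne', not_lt.2 this.le, not_lt.2 h.le]

/-- In the adapted coordinates `M`, inside of `W`, the set `O` is the subgraph and the set `K` the
graph of the `ε`-Lipschitz function `f`. -/
structure IsGraphIn {m : ℕ} (O K W : Set (EuclideanSpace ℝ (Fin (m + 1)))) (ε : NNReal)
    (ν : EuclideanSpace ℝ (Fin (m + 1)))
    (M : (EuclideanSpace ℝ (Fin m) × ℝ) ≃L[ℝ] EuclideanSpace ℝ (Fin (m + 1)))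
    (f : EuclideanSpace ℝ (Fin m) → ℝ) : Prop where
  isAdapted : IsAdapted ν M
  lipschitz : LipschitzWith ε f
  mem_subgraph_iff : ∀ z, M z ∈ W → (M z ∈ O ↔ z.2 < f z.1)
  mem_graph_iff : ∀ z, M z ∈ W → (M z ∈ K ↔ z.2 = f z.1)

theorem HasSmoothBoundary.exists_isGraphIn {m : ℕ} {E : Set (EuclideanSpace ℝ (Fin (m + 1)))}
    (hE : HasSmoothBoundary E) {p : EuclideanSpace ℝ (Fin (m + 1))} (hp : p ∈ frontier E)
    {ε : NNReal} (hε0 : 0 < ε) (hε1 : ε < 1) :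
    ∃ r > 0, ∃ ν M f, IsGraphIn (interior E) (frontier E) (Metric.ball p r) ε ν M f := by
  obtain ⟨U, hU, hpU, φ, hφ, hφ', hφ0, hneg, hpos⟩ := hE p hp
  have hstrict : HasStrictFDerivAt φ (fderiv ℝ φ p) p :=
    (hφ.contDiffAt (hU.mem_nhds hpU)).hasStrictFDerivAt (by simp)
  obtain ⟨ν, M, hM, f, hf, r, hr, hgraph⟩ := exists_graph_of_hasStrictFDerivAt hstrict (hφ' p hpU)
    ((hφ0 p hpU).2 hp) hε0 hε1
  obtain ⟨r', hr', hrU⟩ := Metric.isOpen_iff.1 hU p hpU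
  refine ⟨min r r', lt_min hr hr', ν, M, f, hM, hf, fun z hz => ?_, fun z hz => ?_⟩
  · have hzU := hrU (Metric.ball_subset_ball (min_le_right _ _) hz)
    rw [← (hgraph z (Metric.ball_subset_ball (min_le_left _ _) hz)).1]
    constructor
    · intro hz'
      rcases lt_trichotomy (φ (M z)) 0 with h | h | h
      · exact h
      · exact absurd hz' ((hφ0 _ hzU).1 h).2
      · exact absurd (interior_subset hz') (hpos _ hzU h)
    · intro h
      -- A point of `E` outside the interior would be a boundary point, where `φ` vanishes.
      by_contra hz'
      exact h.ne ((hφ0 _ hzU).2 ⟨subset_closure (hneg _ hzU h), hz'⟩)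
  · have hzU := hrU (Metric.ball_subset_ball (min_le_right _ _) hz)
    rw [← (hgraph z (Metric.ball_subset_ball (min_le_left _ _) hz)).2, hφ0 _ hzU]

/-! ### Surface measure of a nearly flat graph -/

theorem LipschitzWith.euclideanHausdorffMeasure_image_le {X Y : Type*} [EMetricSpace X]
    [EMetricSpace Y] [MeasurableSpace X] [BorelSpace X] [MeasurableSpace Y] [BorelSpace Y]
    {C : NNReal} {g : X → Y} (hg : LipschitzWith C g) (d : ℕ) (A : Set X) :
    Measure.euclideanHausdorffMeasure d (g '' A) ≤
      (C : ℝ≥0∞) ^ d * Measure.euclideanHausdorffMeasure d A := by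
  have h := hg.hausdorffMeasure_image_le (d := d) (Nat.cast_nonneg d) A
  rw [ENNReal.rpow_natCast] at h
  simp only [Measure.euclideanHausdorffMeasure_def, Measure.smul_apply, ENNReal.smul_def, smul_eq_mul]
  rw [mul_left_comm]
  exact mul_le_mul_right h _

namespace IsGraphIn

variable {m : ℕ} {O K W : Set (EuclideanSpace ℝ (Fin (m + 1)))} {ε : NNReal}
  {ν : EuclideanSpace ℝ (Fin (m + 1))}
  {M : (EuclideanSpace ℝ (Fin m) × ℝ) ≃L[ℝ] EuclideanSpace ℝ (Fin (m + 1))}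
  {f : EuclideanSpace ℝ (Fin m) → ℝ}

theorem lipschitz_graph (h : IsGraphIn O K W ε ν M f) : LipschitzWith (1 + ε) fun x => M (x, f x) := by
  refine LipschitzWith.of_dist_le_mul fun x y => ?_
  rw [dist_eq_norm, ← map_sub, dist_eq_norm]
  refine (h.isAdapted.norm_le_add _).trans ?_
  have := h.lipschitz.dist_le_mul x y
  rw [Real.dist_eq, dist_eq_norm] at this
  simp only [Prod.mk_sub_mk, NNReal.coe_add, NNReal.coe_one]
  linarith

/-- The projection from the graph to the plane is 1-Lipschitz. Together with the `(1 + ε)`-Lipschitz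
parametrization used in `image_le_volume`, this replaces the area formula. -/
theorem volume_le_image (h : IsGraphIn O K W ε ν M f) (A : Set (EuclideanSpace ℝ (Fin m))) :
    volume A ≤ Measure.euclideanHausdorffMeasure m ((fun x => M (x, f x)) '' A) := by
  have hl : LipschitzWith 1 fun y => (M.symm y).1 := by
    refine LipschitzWith.of_dist_le_mul fun x y => ?_
    rw [dist_eq_norm, dist_eq_norm, NNReal.coe_one, one_mul]
    have := h.isAdapted.norm_fst_le (M.symm x - M.symm y)
    simpa using this
  have := hl.euclideanHausdorffMeasure_image_le m ((fun x => M (x, f x)) '' A)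
  rw [image_image] at this
  simpa [EuclideanSpace.euclideanHausdorffMeasure_eq_volume] using this

theorem image_le_volume (h : IsGraphIn O K W ε ν M f) (A : Set (EuclideanSpace ℝ (Fin m))) :
    Measure.euclideanHausdorffMeasure m ((fun x => M (x, f x)) '' A) ≤
      (1 + ε : ℝ≥0∞) ^ m * volume A := by
  have := h.lipschitz_graph.euclideanHausdorffMeasure_image_le m A
  simpa [EuclideanSpace.euclideanHausdorffMeasure_eq_volume] using this

theorem continuous_graph (h : IsGraphIn O K W ε ν M f) : Continuous fun x => M (x, f x) :=
  h.lipschitz_graph.continuous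

theorem measurableSet_range (h : IsGraphIn O K W ε ν M f) :
    MeasurableSet (range fun x => M (x, f x)) := by
  have : range (fun x => M (x, f x)) = {y | (M.symm y).2 = f (M.symm y).1} := by
    ext y
    constructor
    · rintro ⟨x, rfl⟩; simp
    · intro hy
      refine ⟨(M.symm y).1, ?_⟩
      have hy' : (M.symm y).2 = f (M.symm y).1 := hy
      simp only [← hy']
      exact M.apply_symm_apply y
  rw [this]
  exact (isClosed_eq (by fun_prop) (h.lipschitz.continuous.comp (by fun_prop))).measurableSet

theorem setLIntegral_eq (h : IsGraphIn O K W ε ν M f) (hK : MeasurableSet K)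
    {η : EuclideanSpace ℝ (Fin (m + 1)) → ℝ≥0∞} (hη : ∀ x, x ∉ W → η x = 0) :
    ∫⁻ x in K, η x ∂Measure.euclideanHausdorffMeasure m =
      ∫⁻ x in range fun x => M (x, f x), η x ∂Measure.euclideanHausdorffMeasure m := by
  rw [← lintegral_indicator hK, ← lintegral_indicator h.measurableSet_range]
  refine lintegral_congr fun y => ?_
  by_cases hy : y ∈ W
  · have h1 := h.mem_graph_iff (M.symm y) (by simpa using hy)
    rw [M.apply_symm_apply] at h1
    have h2 : y ∈ range (fun x => M (x, f x)) ↔ y ∈ K := by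
      rw [h1]
      constructor
      · rintro ⟨x, rfl⟩; simp
      · intro hy
        exact ⟨(M.symm y).1, by simp only [← hy]; exact M.apply_symm_apply y⟩
    by_cases hyK : y ∈ K
    · rw [indicator_of_mem hyK, indicator_of_mem (h2.2 hyK)]
    · rw [indicator_of_notMem hyK, indicator_of_notMem (fun h' => hyK (h2.1 h'))]
  · simp [indicator, hη y hy]

theorem lintegral_le_setLIntegral (h : IsGraphIn O K W ε ν M f) (hK : MeasurableSet K)
    {η : EuclideanSpace ℝ (Fin (m + 1)) → ℝ≥0∞} (hη : ∀ x, x ∉ W → η x = 0) (hm : Measurable η) :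
    ∫⁻ x, η (M (x, f x)) ≤ ∫⁻ x in K, η x ∂Measure.euclideanHausdorffMeasure m := by
  rw [h.setLIntegral_eq hK hη, ← lintegral_map hm h.continuous_graph.measurable]
  refine lintegral_mono' (Measure.le_iff.2 fun B hB => ?_) le_rfl
  rw [Measure.map_apply h.continuous_graph.measurable hB, Measure.restrict_apply hB,
    ← image_preimage_eq_inter_range]
  exact h.volume_le_image _

theorem setLIntegral_le_lintegral (h : IsGraphIn O K W ε ν M f) (hK : MeasurableSet K)
    {η : EuclideanSpace ℝ (Fin (m + 1)) → ℝ≥0∞} (hη : ∀ x, x ∉ W → η x = 0) (hm : Measurable η) :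
    ∫⁻ x in K, η x ∂Measure.euclideanHausdorffMeasure m ≤
      (1 + ε : ℝ≥0∞) ^ m * ∫⁻ x, η (M (x, f x)) := by
  rw [h.setLIntegral_eq hK hη, ← lintegral_map hm h.continuous_graph.measurable,
    ← smul_eq_mul, ← lintegral_smul_measure]
  refine lintegral_mono' (Measure.le_iff.2 fun B hB => ?_) le_rfl
  rw [Measure.smul_apply, Measure.map_apply h.continuous_graph.measurable hB,
    Measure.restrict_apply hB, ← image_preimage_eq_inter_range]
  exact h.image_le_volume _

end IsGraphIn

/-! ### Volume crossing a graph under a translation -/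

namespace IsGraphIn

variable {m : ℕ} {O K W : Set (EuclideanSpace ℝ (Fin (m + 1)))} {ε : NNReal}
  {ν : EuclideanSpace ℝ (Fin (m + 1))}
  {M : (EuclideanSpace ℝ (Fin m) × ℝ) ≃L[ℝ] EuclideanSpace ℝ (Fin (m + 1))}
  {f : EuclideanSpace ℝ (Fin m) → ℝ}

/-- The integral of `η` over the graph lowered by `u` depends continuously on `u`, because the
compact support confines `x` to a fixed ball. -/
theorem exists_lintegral_translate_near (h : IsGraphIn O K W ε ν M f)
    {η : EuclideanSpace ℝ (Fin (m + 1)) → ℝ} (hη : Continuous η) (hηc : HasCompactSupport η)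
    (hη0 : ∀ x, 0 ≤ η x) {τ : ℝ≥0∞} (hτ : τ ≠ 0) :
    ∫⁻ x, ENNReal.ofReal (η (M (x, f x))) ≠ ⊤ ∧ ∃ δ > 0, ∀ u : ℝ, |u| < δ →
      ∫⁻ x, ENNReal.ofReal (η (M (x, f x - u))) ≤ (∫⁻ x, ENNReal.ofReal (η (M (x, f x)))) + τ ∧
      ∫⁻ x, ENNReal.ofReal (η (M (x, f x))) ≤ (∫⁻ x, ENNReal.ofReal (η (M (x, f x - u)))) + τ := by
  obtain ⟨R, hR⟩ := hηc.isCompact.isBounded.subset_closedBall (0 : EuclideanSpace ℝ (Fin (m + 1)))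
  have hfc := h.lipschitz.continuous
  have hcont : Continuous fun u : ℝ =>
      ∫ x in Metric.closedBall (0 : EuclideanSpace ℝ (Fin m)) R, η (M (x, f x - u)) := by
    refine continuous_parametric_integral_of_continuous ?_ (isCompact_closedBall _ _)
    fun_prop
  have heq : ∀ u : ℝ, ∫⁻ x, ENNReal.ofReal (η (M (x, f x - u))) = ENNReal.ofReal
      (∫ x in Metric.closedBall (0 : EuclideanSpace ℝ (Fin m)) R, η (M (x, f x - u))) := by
    intro u
    have hsupp : ∀ x, x ∉ Metric.closedBall (0 : EuclideanSpace ℝ (Fin m)) R →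
        η (M (x, f x - u)) = 0 := by
      intro x hx
      by_contra hne
      have h1 := hR (subset_tsupport _ (Function.mem_support.2 hne))
      rw [mem_closedBall_zero_iff] at h1 hx
      exact hx ((h.isAdapted.norm_fst_le (x, f x - u)).trans h1)
    rw [ofReal_integral_eq_lintegral_ofReal
      ((by fun_prop : Continuous fun x => η (M (x, f x - u))).continuousOn.integrableOn_compact
        (isCompact_closedBall _ _)) (Eventually.of_forall fun x => hη0 _)]
    rw [← lintegral_indicator Metric.isClosed_closedBall.measurableSet]
    refine lintegral_congr fun x => ?_
    by_cases hx : x ∈ Metric.closedBall (0 : EuclideanSpace ℝ (Fin m)) R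
    · rw [indicator_of_mem hx]
    · rw [indicator_of_notMem hx, hsupp x hx, ENNReal.ofReal_zero]
  have hI : Continuous fun u : ℝ => ∫⁻ x, ENNReal.ofReal (η (M (x, f x - u))) := by
    simp_rw [heq]
    exact ENNReal.continuous_ofReal.comp hcont
  have h0 : ∫⁻ x, ENNReal.ofReal (η (M (x, f x))) =
      ∫⁻ x, ENNReal.ofReal (η (M (x, f x - 0))) := by simp
  have htop : ∫⁻ x, ENNReal.ofReal (η (M (x, f x - 0))) ≠ ⊤ := by
    rw [heq]; exact ENNReal.ofReal_ne_top
  rw [h0]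
  refine ⟨htop, ?_⟩
  have h1 := (ENNReal.tendsto_nhds htop).1 (hI.tendsto 0) τ (pos_iff_ne_zero.2 hτ)
  obtain ⟨δ, hδ, hδ'⟩ := Metric.eventually_nhds_iff.1 h1
  refine ⟨δ, hδ, fun u hu => ?_⟩
  have := hδ' (y := u) (by simpa using hu)
  exact ⟨this.2, tsub_le_iff_right.1 this.1⟩

/-- With `u` the depth below the graph, a point crosses exactly when `u` is positive and at most the
rise of `v` minus the rise of `f`. -/
theorem lintegral_crossing_eq (h : IsGraphIn O K W ε ν M f)
    (hO : IsOpen O) {η : EuclideanSpace ℝ (Fin (m + 1)) → ℝ≥0∞} (hη : Measurable η)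
    {v : EuclideanSpace ℝ (Fin (m + 1))} (hv : ∀ x, η x ≠ 0 → x ∈ W ∧ x + v ∈ W) :
    ∫⁻ x in {x | x ∈ O ∧ x + v ∉ O}, η x = ∫⁻ x, ∫⁻ u in
      Ioc 0 ((M.symm v).2 - (f (x + (M.symm v).1) - f x)), η (M (x, f x - u)) := by
  have hms : MeasurableSet {x | x ∈ O ∧ x + v ∉ O} :=
    hO.measurableSet.inter (hO.preimage (continuous_add_const v)).measurableSet.compl
  rw [← lintegral_indicator hms, ← h.isAdapted.measurePreserving.lintegral_comp
    (hη.indicator hms), Measure.volume_eq_prod,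
    lintegral_prod (fun z => {x | x ∈ O ∧ x + v ∉ O}.indicator η (M z)) ((hη.indicator hms).comp M.continuous.measurable).aemeasurable]
  refine lintegral_congr fun x => ?_
  rw [← lintegral_sub_left_eq_self _ (f x), ← lintegral_indicator measurableSet_Ioc]
  refine lintegral_congr fun u => ?_
  by_cases hz : η (M (x, f x - u)) = 0
  · simp [indicator, hz]
  · obtain ⟨h1, h2⟩ := hv _ hz
    have h3 := h.mem_subgraph_iff _ h1
    have e : M (x, f x - u) + v = M (x + (M.symm v).1, f x - u + (M.symm v).2) := by
      conv_lhs => rw [← M.apply_symm_apply v, ← map_add]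
      rfl
    have h4 := h.mem_subgraph_iff _ (e ▸ h2)
    have : M (x, f x - u) ∈ {x | x ∈ O ∧ x + v ∉ O} ↔
        u ∈ Ioc 0 ((M.symm v).2 - (f (x + (M.symm v).1) - f x)) := by
      rw [mem_ofPred_eq, e, h3, h4, mem_Ioc, not_lt]
      refine and_congr (by simp) ?_
      constructor <;> intro h <;> linarith
    by_cases hk : M (x, f x - u) ∈ {x | x ∈ O ∧ x + v ∉ O}
    · rw [indicator_of_mem hk, indicator_of_mem (this.1 hk)]
    · rw [indicator_of_notMem hk, indicator_of_notMem (fun h' => hk (this.2 h'))]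

theorem abs_sub_le (h : IsGraphIn O K W ε ν M f) (x : EuclideanSpace ℝ (Fin m))
    (v : EuclideanSpace ℝ (Fin (m + 1))) : |f (x + (M.symm v).1) - f x| ≤ ε * ‖v‖ := by
  have h1 := h.lipschitz.dist_le_mul (x + (M.symm v).1) x
  rw [Real.dist_eq, dist_eq_norm, add_sub_cancel_left] at h1
  have h2 := h.isAdapted.norm_fst_le (M.symm v)
  rw [M.apply_symm_apply] at h2
  exact h1.trans (by gcongr)

theorem snd_symm (h : IsGraphIn O K W ε ν M f) (v : EuclideanSpace ℝ (Fin (m + 1))) :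
    (M.symm v).2 = inner ℝ ν v := by
  rw [← h.isAdapted.inner_apply, M.apply_symm_apply]

theorem lintegral_lintegral_Ioc (h : IsGraphIn O K W ε ν M f)
    {η : EuclideanSpace ℝ (Fin (m + 1)) → ℝ≥0∞} (hη : Measurable η) (b : ℝ) :
    ∫⁻ x, ∫⁻ u in Ioc 0 b, η (M (x, f x - u)) = ∫⁻ u in Ioc 0 b, ∫⁻ x, η (M (x, f x - u)) := by
  have hfc := h.lipschitz.continuous
  refine lintegral_lintegral_swap (Measurable.aemeasurable ?_)
  exact hη.comp (by fun_prop : Continuous fun p : EuclideanSpace ℝ (Fin m) × ℝ =>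
    M (p.1, f p.1 - p.2)).measurable

/-- The Lipschitz bound traps the upper end of the depth interval between `ν·v - ε‖v‖` and `ν·v +
ε‖v‖`. Once it no longer depends on `x`, the integrals can be exchanged, and each layer has nearly
the integral over the graph itself. -/
theorem exists_lintegral_crossing_near (h : IsGraphIn O K W ε ν M f) (hO : IsOpen O) (hW : IsOpen W)
    (hε : ε ≤ 1)
    {η : EuclideanSpace ℝ (Fin (m + 1)) → ℝ} (hη : Continuous η) (hηc : HasCompactSupport η)
    (hηW : tsupport η ⊆ W) (hη0 : ∀ x, 0 ≤ η x) {τ : ℝ≥0∞} (hτ : τ ≠ 0) :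
    ∃ δ > 0, ∀ v, ‖v‖ < δ →
      ∫⁻ x in {x | x ∈ O ∧ x + v ∉ O}, ENNReal.ofReal (η x) ≤
        (∫⁻ x, ENNReal.ofReal (η (M (x, f x)))) * ENNReal.ofReal (inner ℝ ν v) +
          ((∫⁻ x, ENNReal.ofReal (η (M (x, f x)))) * ε + 2 * τ) * ‖v‖ₑ ∧
      (∫⁻ x, ENNReal.ofReal (η (M (x, f x)))) * ENNReal.ofReal (inner ℝ ν v) ≤
        (∫⁻ x in {x | x ∈ O ∧ x + v ∉ O}, ENNReal.ofReal (η x)) +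
          ((∫⁻ x, ENNReal.ofReal (η (M (x, f x)))) * ε + 2 * τ) * ‖v‖ₑ := by
  obtain ⟨-, δ₁, hδ₁, hnear⟩ := h.exists_lintegral_translate_near hη hηc hη0 hτ
  obtain ⟨δ₂, hδ₂, hthick⟩ := hηc.isCompact.exists_thickening_subset_open hW hηW
  set I := ∫⁻ x, ENNReal.ofReal (η (M (x, f x))) with hI
  have hηm : Measurable fun x => ENNReal.ofReal (η x) := by fun_prop
  -- Depths reach at most `2‖v‖`, hence `δ₁ / 2`; `δ₂` keeps `x + v` inside `W`.
  refine ⟨min (δ₁ / 2) δ₂, by positivity, fun v hv => ?_⟩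
  have hv1 : 2 * ‖v‖ < δ₁ := by linarith [hv.trans_le (min_le_left _ _)]
  have hv2 : ‖v‖ < δ₂ := hv.trans_le (min_le_right _ _)
  have hεr : (ε : ℝ) ≤ 1 := hε
  have hcross := h.lintegral_crossing_eq hO hηm (v := v) (by
    intro x hx
    have hx' : x ∈ tsupport η := by
      refine subset_tsupport _ (Function.mem_support.2 fun h0 => hx ?_)
      simp [h0]
    refine ⟨hηW hx', hthick ?_⟩
    rw [Metric.mem_thickening_iff]
    exact ⟨x, hx', by simpa using hv2⟩)
  have hin : inner ℝ ν v ≤ ‖v‖ := by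
    simpa [h.isAdapted.norm_eq_one] using real_inner_le_norm ν v
  have hεv : (ε : ℝ) * ‖v‖ ≤ ‖v‖ := by nlinarith [norm_nonneg v]
  have hεv0 : 0 ≤ (ε : ℝ) * ‖v‖ := by positivity
  have hofε : ENNReal.ofReal (ε * ‖v‖) = ε * ‖v‖ₑ := by
    rw [ENNReal.ofReal_mul (p := (ε : ℝ)) ε.2, ofReal_norm, ENNReal.ofReal_coe_nnreal]
  have hle2 : ∀ b : ℝ, b ≤ 2 * ‖v‖ → ENNReal.ofReal b ≤ 2 * ‖v‖ₑ := by
    intro b hb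
    refine (ENNReal.ofReal_le_ofReal hb).trans (le_of_eq ?_)
    rw [ENNReal.ofReal_mul (by norm_num), ofReal_norm]; simp
  have hu : ∀ b : ℝ, b ≤ 2 * ‖v‖ → ∀ u ∈ Ioc 0 b, |u| < δ₁ := by
    intro b hb u hu
    rw [abs_of_pos hu.1]; linarith [hu.2]
  rw [hcross, h.snd_symm]
  constructor
  · set b := inner ℝ ν v + ε * ‖v‖ with hb
    have hb2 : b ≤ 2 * ‖v‖ := by linarith
    calc _ ≤ ∫⁻ x, ∫⁻ u in Ioc 0 b, ENNReal.ofReal (η (M (x, f x - u))) := by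
          refine lintegral_mono fun x => lintegral_mono_set (Ioc_subset_Ioc_right ?_)
          have := (abs_le.1 (h.abs_sub_le x v)).1
          linarith
      _ = ∫⁻ u in Ioc 0 b, ∫⁻ x, ENNReal.ofReal (η (M (x, f x - u))) :=
          h.lintegral_lintegral_Ioc hηm b
      _ ≤ ∫⁻ u in Ioc 0 b, (I + τ) :=
          setLIntegral_mono' measurableSet_Ioc fun u hu' => (hnear u (hu b hb2 u hu')).1
      _ = I * ENNReal.ofReal b + τ * ENNReal.ofReal b := by
          rw [setLIntegral_const, Real.volume_Ioc, sub_zero, add_mul]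
      _ ≤ I * (ENNReal.ofReal (inner ℝ ν v) + ε * ‖v‖ₑ) + τ * (2 * ‖v‖ₑ) := by
          gcongr
          · rw [← hofε]; exact ENNReal.ofReal_add_le
          · exact hle2 b hb2
      _ = _ := by ring
  · set b := inner ℝ ν v - ε * ‖v‖ with hb
    have hb2 : b ≤ 2 * ‖v‖ := by linarith [norm_nonneg v]
    have h1 : I * ENNReal.ofReal b ≤ (∫⁻ x, ∫⁻ u in
        Ioc 0 (inner ℝ ν v - (f (x + (M.symm v).1) - f x)), ENNReal.ofReal (η (M (x, f x - u)))) +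
        τ * (2 * ‖v‖ₑ) := by
      calc I * ENNReal.ofReal b = ∫⁻ u in Ioc 0 b, I := by
            rw [setLIntegral_const, Real.volume_Ioc, sub_zero]
        _ ≤ ∫⁻ u in Ioc 0 b, ((∫⁻ x, ENNReal.ofReal (η (M (x, f x - u)))) + τ) :=
            setLIntegral_mono' measurableSet_Ioc fun u hu' => (hnear u (hu b hb2 u hu')).2
        _ = (∫⁻ x, ∫⁻ u in Ioc 0 b, ENNReal.ofReal (η (M (x, f x - u)))) + τ * ENNReal.ofReal b := by
            rw [lintegral_add_right _ measurable_const, h.lintegral_lintegral_Ioc hηm b,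
              setLIntegral_const, Real.volume_Ioc, sub_zero]
        _ ≤ _ := by
            refine add_le_add (lintegral_mono fun x => lintegral_mono_set (Ioc_subset_Ioc_right ?_))
              (mul_le_mul_right (hle2 b hb2) _)
            have := (abs_le.1 (h.abs_sub_le x v)).2
            linarith
    calc I * ENNReal.ofReal (inner ℝ ν v) ≤ I * (ENNReal.ofReal b + ε * ‖v‖ₑ) := by
          gcongr
          rw [← hofε]
          refine le_trans (le_of_eq ?_) ENNReal.ofReal_add_le
          rw [hb, sub_add_cancel]
      _ = I * ENNReal.ofReal b + I * ε * ‖v‖ₑ := by ring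
      _ ≤ _ := by
          refine (add_le_add_left h1 _).trans (le_of_eq ?_)
          ring

end IsGraphIn

/-! ### From local pieces to the whole boundary -/

/-- The segment from `x` to `x + v` is connected, so it meets the frontier. Crossing points
therefore lie where the partition of unity sums to one. -/
theorem mem_cthickening_frontier_of_crossing {X : Type*} [NormedAddCommGroup X] [NormedSpace ℝ X]
    {O : Set X} (hO : IsOpen O) {x v : X} (hx : x ∈ O) (hxv : x + v ∉ O) {δ : ℝ} (hv : ‖v‖ ≤ δ) :
    x ∈ Metric.cthickening δ (frontier O) := by
  have hpre : IsPreconnected (segment ℝ x (x + v)) := (convex_segment x (x + v)).isPreconnected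
  obtain ⟨y, hy, hyO⟩ : ∃ y ∈ segment ℝ x (x + v), y ∈ frontier O := by
    by_contra! hno
    have hout : ∀ y ∈ segment ℝ x (x + v), y ∉ O → y ∉ closure O := fun y hy hyO hyc =>
      hno y hy ⟨hyc, fun h => hyO (interior_subset h)⟩
    obtain ⟨y, -, hy1, hy2⟩ := hpre O (closure O)ᶜ hO isClosed_closure.isOpen_compl
      (fun y hy => or_iff_not_imp_left.2 (hout y hy)) ⟨x, left_mem_segment ℝ _ _, hx⟩
      ⟨x + v, right_mem_segment ℝ _ _, hout _ (right_mem_segment ℝ _ _) hxv⟩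
    exact hy2 (subset_closure hy1)
  refine Metric.mem_cthickening_of_dist_le x y δ _ hyO ?_
  have := segment_subset_closedBall_left x (x + v) hy
  rw [Metric.mem_closedBall, dist_comm] at this
  refine this.trans ?_
  simpa [dist_eq_norm] using hv

theorem lintegral_eq_sum_of_partition {X ι : Type*} [MeasurableSpace X] [Fintype ι] {μ : Measure X}
    {S : Set X} (hS : MeasurableSet S) {η : ι → X → ℝ} (hη : ∀ i, Measurable (η i))
    (hη0 : ∀ i x, 0 ≤ η i x) (hsum : ∀ x ∈ S, ∑ i, η i x = 1) :
    μ S = ∑ i, ∫⁻ x in S, ENNReal.ofReal (η i x) ∂μ := by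
  rw [← lintegral_finsetSum _ (fun i _ => (hη i).ennreal_ofReal), ← setLIntegral_one]
  refine setLIntegral_congr_fun hS fun x hx => ?_
  rw [← ENNReal.ofReal_sum_of_nonneg fun i _ => hη0 i x, hsum x hx, ENNReal.ofReal_one]

/-- The weight `aᵢ` is the integral of the cutoff `ηᵢ` over the parametrizing plane, so `∑ aᵢ`
matches the surface measure up to `(1 + ε) ^ m`. The pieces are fixed before `τ`, so that `τ` may
later be chosen in terms of their number. -/
theorem exists_approx_crossing {m : ℕ} {O K : Set (EuclideanSpace ℝ (Fin (m + 1)))} (hO : IsOpen O)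
    (hK : IsCompact K) (hOK : frontier O ⊆ K) {ε : NNReal} (hε : ε ≤ 1)
    (hgraph : ∀ p ∈ K, ∃ r > 0, ∃ ν M f, IsGraphIn O K (Metric.ball p r) ε ν M f) :
    ∃ (N : ℕ) (ν : Fin N → EuclideanSpace ℝ (Fin (m + 1))) (a : Fin N → ℝ≥0∞),
      (∀ i, ‖ν i‖ = 1) ∧ (∀ i, a i ≠ ⊤) ∧
      ∑ i, a i ≤ Measure.euclideanHausdorffMeasure m K ∧
      Measure.euclideanHausdorffMeasure m K ≤ (1 + ε) ^ m * ∑ i, a i ∧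
      ∀ τ : ℝ≥0∞, τ ≠ 0 → ∃ δ > 0, ∀ v, ‖v‖ < δ →
        volume {x | x ∈ O ∧ x + v ∉ O} ≤ ∑ i, a i * ENNReal.ofReal (inner ℝ (ν i) v) +
          (∑ i, (a i * ε + 2 * τ)) * ‖v‖ₑ ∧
        ∑ i, a i * ENNReal.ofReal (inner ℝ (ν i) v) ≤ volume {x | x ∈ O ∧ x + v ∉ O} +
          (∑ i, (a i * ε + 2 * τ)) * ‖v‖ₑ := by
  choose r hr ν M f hG using hgraph
  obtain ⟨t, ht⟩ := hK.elim_nhds_subcover' (fun p hp => Metric.ball p (r p hp))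
    fun p hp => Metric.ball_mem_nhds _ (hr p hp)
  set e := t.equivFin.symm with he
  set q : Fin t.card → K := fun i => (e i : K) with hq
  set W : Fin t.card → Set (EuclideanSpace ℝ (Fin (m + 1))) :=
    fun i => Metric.ball (q i : EuclideanSpace ℝ (Fin (m + 1))) (r (q i) (q i).2) with hW
  have hcover : K ⊆ ⋃ i, W i := by
    intro x hx
    obtain ⟨p, hp, hxp⟩ := mem_iUnion₂.1 (ht hx)
    refine mem_iUnion.2 ⟨t.equivFin ⟨p, hp⟩, ?_⟩
    simpa [hW, hq, he] using hxp
  have hWo : ∀ i, IsOpen (W i) := fun i => Metric.isOpen_ball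
  obtain ⟨δ₀, hδ₀, hδW⟩ := hK.exists_cthickening_subset_open (isOpen_iUnion hWo) hcover
  obtain ⟨η, hηW, hηsum, hη01, hηc⟩ :=
    exists_continuous_sum_one_of_isOpen_isCompact hWo hK.cthickening hδW
  have hsum : ∀ x ∈ Metric.cthickening δ₀ K, ∑ i, η i x = 1 := by
    intro x hx; simpa using hηsum hx
  have hη0 : ∀ i x, 0 ≤ η i x := fun i x => (hη01 i x).1
  have hηm : ∀ i, Measurable (η i) := fun i => (η i).continuous.measurable
  have hgr : ∀ i, IsGraphIn O K (W i) ε (ν _ (q i).2) (M _ (q i).2) (f _ (q i).2) :=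
    fun i => hG _ (q i).2
  have hout : ∀ i x, x ∉ W i → ENNReal.ofReal (η i x) = 0 := by
    intro i x hx
    rw [image_eq_zero_of_notMem_tsupport fun h => hx (hηW i h), ENNReal.ofReal_zero]
  have hHK := lintegral_eq_sum_of_partition (μ := Measure.euclideanHausdorffMeasure m)
    hK.measurableSet hηm hη0 fun x hx => hsum x (Metric.self_subset_cthickening K hx)
  refine ⟨t.card, fun i => ν _ (q i).2,
    fun i => ∫⁻ x, ENNReal.ofReal (η i (M _ (q i).2 (x, f _ (q i).2 x))),
    fun i => (hgr i).isAdapted.norm_eq_one, fun i =>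
      ((hgr i).exists_lintegral_translate_near (η i).continuous (hηc i) (hη0 i) one_ne_zero).1,
    ?_, ?_, fun τ hτ => ?_⟩
  · rw [hHK]
    exact Finset.sum_le_sum fun i _ =>
      (hgr i).lintegral_le_setLIntegral hK.measurableSet (hout i) (hηm i).ennreal_ofReal
  · rw [hHK, Finset.mul_sum]
    exact Finset.sum_le_sum fun i _ =>
      (hgr i).setLIntegral_le_lintegral hK.measurableSet (hout i) (hηm i).ennreal_ofReal
  · choose δ hδ hnear using fun i => (hgr i).exists_lintegral_crossing_near hO (hWo i) hε
      (η i).continuous (hηc i) (hηW i) (hη0 i) hτ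
    obtain ⟨δ₁, hδ₁, hle⟩ : ∃ δ₁ > 0, ∀ i, δ₁ ≤ δ i := by
      have : ∀ᶠ d in 𝓝[>] (0 : ℝ), ∀ i, d ≤ δ i := by
        rw [eventually_all]
        intro i
        filter_upwards [Ioc_mem_nhdsGT (hδ i)] with d hd using hd.2
      obtain ⟨d, hd, hd0⟩ := (this.and self_mem_nhdsWithin).exists
      exact ⟨d, hd0, hd⟩
    refine ⟨min δ₀ δ₁, lt_min hδ₀ hδ₁, fun v hv => ?_⟩
    have hv0 : ‖v‖ ≤ δ₀ := (hv.trans_le (min_le_left _ _)).le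
    have hvi : ∀ i, ‖v‖ < δ i := fun i => hv.trans_le ((min_le_right _ _).trans (hle i))
    have hms : MeasurableSet {x | x ∈ O ∧ x + v ∉ O} :=
      hO.measurableSet.inter (hO.preimage (continuous_add_const v)).measurableSet.compl
    rw [lintegral_eq_sum_of_partition hms hηm hη0 fun x hx => hsum x
      (Metric.cthickening_subset_of_subset _ hOK (mem_cthickening_frontier_of_crossing hO hx.1 hx.2 hv0)),
      Finset.sum_mul, ← Finset.sum_add_distrib, ← Finset.sum_add_distrib]
    exact ⟨Finset.sum_le_sum fun i _ => (hnear i v (hvi i)).1,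
      Finset.sum_le_sum fun i _ => (hnear i v (hvi i)).2⟩

theorem euclideanHausdorffMeasure_lt_top {m : ℕ} {O K : Set (EuclideanSpace ℝ (Fin (m + 1)))}
    (hO : IsOpen O) (hK : IsCompact K) (hOK : frontier O ⊆ K) {ε : NNReal} (hε : ε ≤ 1)
    (hgraph : ∀ p ∈ K, ∃ r > 0, ∃ ν M f, IsGraphIn O K (Metric.ball p r) ε ν M f) :
    Measure.euclideanHausdorffMeasure m K < ⊤ := by
  obtain ⟨N, ν, a, -, ha, -, hle, -⟩ := exists_approx_crossing hO hK hOK hε hgraph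
  refine hle.trans_lt (ENNReal.mul_lt_top (by finiteness) ?_)
  exact ENNReal.sum_lt_top.2 fun i _ => (ha i).lt_top

/-- For `S ≤ H` the excess `((1 + x) ^ m - 1) S` is at most `H ((1 + x) ^ m - 1)`, which tends to
`0` with `x`. -/
theorem exists_small_error {H : ℝ≥0∞} (hH : H ≠ ⊤) (m : ℕ) {ε : ℝ≥0∞} (hε : ε ≠ 0) :
    ∃ x : NNReal, 0 < x ∧ x < 1 ∧ H * x ≤ ε ∧ ∀ S, S ≤ H → (1 + x) ^ m * S ≤ S + ε := by
  have h1 : Tendsto (fun x : NNReal => H * (((1 + x) ^ m - 1 : NNReal) : ℝ≥0∞)) (𝓝[>] 0) (𝓝 0) := by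
    have hc : Continuous fun x : NNReal => (1 + x) ^ m - 1 := by fun_prop
    have h2 := ENNReal.Tendsto.const_mul (a := H)
      (ENNReal.tendsto_coe.2 (hc.tendsto 0)) (Or.inr hH)
    simp only [add_zero, one_pow, tsub_self, ENNReal.coe_zero, mul_zero] at h2
    exact h2.mono_left nhdsWithin_le_nhds
  have h2 : Tendsto (fun x : NNReal => H * (x : ℝ≥0∞)) (𝓝[>] 0) (𝓝 0) := by
    have h2 := ENNReal.Tendsto.const_mul (a := H)
      (ENNReal.tendsto_coe.2 (tendsto_id (α := NNReal) (x := 𝓝 0))) (Or.inr hH)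
    simp only [id, ENNReal.coe_zero, mul_zero] at h2
    exact h2.mono_left nhdsWithin_le_nhds
  have hε' := pos_iff_ne_zero.2 hε
  obtain ⟨x, hx1, hx2, hx⟩ := ((h1.eventually (ge_mem_nhds hε')).and
    ((h2.eventually (ge_mem_nhds hε')).and (Ioo_mem_nhdsGT (zero_lt_one (α := NNReal))))).exists
  refine ⟨x, hx.1, hx.2, hx2, fun S hS => ?_⟩
  have h3 : ((1 + x : ℝ≥0∞)) ^ m = 1 + (((1 + x) ^ m - 1 : NNReal) : ℝ≥0∞) := by
    have : (1 + x) ^ m = 1 + ((1 + x) ^ m - 1) := (add_tsub_cancel_of_le (one_le_pow₀ (by simp))).symm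
    exact_mod_cast congrArg (fun y : NNReal => (y : ℝ≥0∞)) this
  rw [h3, add_mul, one_mul, mul_comm _ S]
  gcongr
  exact (mul_le_mul_left hS _).trans hx1

theorem tendsto_crossing {m : ℕ} {O K : Set (EuclideanSpace ℝ (Fin (m + 1)))} (hO : IsOpen O)
    (hOb : Bornology.IsBounded O) (hK : IsCompact K) (hOK : frontier O ⊆ K)
    (hgraph : ∀ ε : NNReal, 0 < ε → ε < 1 → ∀ p ∈ K, ∃ r > 0, ∃ ν M f,
      IsGraphIn O K (Metric.ball p r) ε ν M f) :
    Tendsto (fun s : ℝ => ENNReal.ofReal (1 - 2 * s) *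
      ∫⁻ h, volume {x | x ∈ O ∧ x + h ∉ O} * (1 / ‖h‖ₑ ^ (((m + 1 : ℕ) : ℝ) + 2 * s)))
      (𝓝[<] (1 / 2 : ℝ)) (𝓝 (unitBallVolume m * Measure.euclideanHausdorffMeasure m K)) := by
  have hH : Measure.euclideanHausdorffMeasure m K ≠ ⊤ :=
    (euclideanHausdorffMeasure_lt_top hO hK hOK (ε := 1 / 2) (half_le_self zero_le_one)
      (hgraph (1 / 2) (half_pos one_pos) (half_lt_self one_pos))).ne
  refine tendsto_mul_lintegral_kernel hOb.measure_lt_top.ne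
    (fun h => measure_mono fun x hx => hx.1) hH fun ε hε hεt => ?_
  obtain ⟨x, hx0, hx1, hHx, hS⟩ := exists_small_error hH m (ENNReal.half_pos hε).ne'
  obtain ⟨N, ν, a, hν, ha, haH, hHa, hτ⟩ := exists_approx_crossing hO hK hOK hx1.le (hgraph x hx0 hx1)
  -- The `N` errors `2τ` must sum to at most `ε / 2`; the `+ 1` keeps the denominator nonzero when
  -- there are no pieces.
  obtain ⟨δ, hδ, hnear⟩ := hτ (ε / 2 / (N * 2 + 1)) (by
    refine (ENNReal.div_pos (ENNReal.half_pos hε).ne' (by finiteness)).ne')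
  have herr : ∑ i, (a i * x + 2 * (ε / 2 / (N * 2 + 1))) ≤ ε := by
    rw [Finset.sum_add_distrib, ← Finset.sum_mul, Finset.sum_const, Finset.card_univ, Fintype.card_fin,
      nsmul_eq_mul]
    calc (∑ i, a i) * x + N * (2 * (ε / 2 / (N * 2 + 1))) ≤
          Measure.euclideanHausdorffMeasure m K * x + (ε / 2 / (N * 2 + 1)) * (N * 2 + 1) := by
          refine add_le_add (mul_le_mul_left haH _) ?_
          calc N * (2 * (ε / 2 / (N * 2 + 1))) = (ε / 2 / (N * 2 + 1)) * (N * 2) := by ring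
            _ ≤ _ := mul_le_mul_right le_self_add _
      _ ≤ ε / 2 + ε / 2 := by
          gcongr
          exact (ENNReal.div_mul_cancel (by simp) (by finiteness)).le
      _ = ε := ENNReal.add_halves ε
  refine ⟨N, ν, a, δ, hδ, hν, fun h hh => ?_, fun h hh => ?_, haH.trans le_self_add,
    (hHa.trans (hS _ haH)).trans ?_⟩
  · exact (hnear h hh).1.trans (by gcongr)
  · exact (hnear h hh).2.trans (by gcongr)
  · gcongr; exact ENNReal.half_le_self

/-! ### The fractional perimeter as an integral over translations -/

theorem fracPerimeter_univ {n : ℕ} (s : ℝ) (E : Set (EuclideanSpace ℝ (Fin n))) :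
    fracPerimeter s E univ = interaction s E Eᶜ := by
  simp [fracPerimeter, interaction]

theorem interaction_congr {n : ℕ} (s : ℝ) {S S' T T' : Set (EuclideanSpace ℝ (Fin n))}
    (hS : S =ᵐ[volume] S') (hT : T =ᵐ[volume] T') : interaction s S T = interaction s S' T' := by
  unfold interaction
  rw [setLIntegral_congr]
  exact Measure.set_prod_ae_eq hS hT

theorem interaction_compl_eq {n : ℕ} (s : ℝ) {O : Set (EuclideanSpace ℝ (Fin n))} (hO : IsOpen O) :
    interaction s O Oᶜ =
      ∫⁻ h, volume {x | x ∈ O ∧ x + h ∉ O} * (1 / ‖h‖ₑ ^ ((n : ℝ) + 2 * s)) := by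
  have hprod : MeasurableSet (O ×ˢ Oᶜ) := hO.measurableSet.prod hO.measurableSet.compl
  have hF : Measurable fun z : EuclideanSpace ℝ (Fin n) × EuclideanSpace ℝ (Fin n) =>
      (O ×ˢ Oᶜ).indicator (fun z => 1 / ‖z.1 - z.2‖ₑ ^ ((n : ℝ) + 2 * s)) z :=
    (by fun_prop : Measurable fun z : EuclideanSpace ℝ (Fin n) × EuclideanSpace ℝ (Fin n) =>
      1 / ‖z.1 - z.2‖ₑ ^ ((n : ℝ) + 2 * s)).indicator hprod
  unfold interaction
  rw [← lintegral_indicator hprod, Measure.volume_eq_prod, lintegral_prod _ hF.aemeasurable]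
  have hshift : ∀ x, ∫⁻ y, (O ×ˢ Oᶜ).indicator
        (fun z => 1 / ‖z.1 - z.2‖ₑ ^ ((n : ℝ) + 2 * s)) (x, y) =
      ∫⁻ h, (O ×ˢ Oᶜ).indicator (fun z => 1 / ‖z.1 - z.2‖ₑ ^ ((n : ℝ) + 2 * s)) (x, x + h) :=
    fun x => (lintegral_add_left_eq_self _ x).symm
  simp_rw [hshift]
  rw [lintegral_lintegral_swap (f := fun x h => (O ×ˢ Oᶜ).indicator
    (fun z => 1 / ‖z.1 - z.2‖ₑ ^ ((n : ℝ) + 2 * s)) (x, x + h)) (hF.comp (by fun_prop : Measurable fun z :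
    EuclideanSpace ℝ (Fin n) × EuclideanSpace ℝ (Fin n) => (z.1, z.1 + z.2))).aemeasurable]
  refine lintegral_congr fun h => ?_
  have hms : MeasurableSet {x | x ∈ O ∧ x + h ∉ O} :=
    hO.measurableSet.inter (hO.preimage (continuous_add_const h)).measurableSet.compl
  rw [mul_comm (volume _), ← setLIntegral_const, ← lintegral_indicator hms]
  refine lintegral_congr fun x => ?_
  by_cases hx : x ∈ O ∧ x + h ∉ O
  · rw [indicator_of_mem (show (x, x + h) ∈ O ×ˢ Oᶜ from hx),
      indicator_of_mem (show x ∈ {x | x ∈ O ∧ x + h ∉ O} from hx)]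
    simp
  · rw [indicator_of_notMem (show (x, x + h) ∉ O ×ˢ Oᶜ from hx),
      indicator_of_notMem (show x ∉ {x | x ∈ O ∧ x + h ∉ O} from hx)]

theorem mainTheorem7 (n : ℕ) (hn : 1 ≤ n) (E : Set (EuclideanSpace ℝ (Fin n)))
    (hE : Bornology.IsBounded E) (hsmooth : HasSmoothBoundary E) :
    classicalPerimeter E univ < ⊤ ∧
      Tendsto (fun s : ℝ => ENNReal.ofReal (1 - 2 * s) * fracPerimeter s E univ)
        (𝓝[<] (1 / 2 : ℝ)) (𝓝 (unitBallVolume (n - 1) * classicalPerimeter E univ)) := by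
  obtain ⟨m, rfl⟩ : ∃ m, n = m + 1 := ⟨n - 1, by omega⟩
  have hK : IsCompact (frontier E) :=
    Metric.isCompact_of_isClosed_isBounded isClosed_frontier (hE.closure.subset frontier_subset_closure)
  have hgraph : ∀ ε : NNReal, 0 < ε → ε < 1 → ∀ p ∈ frontier E, ∃ r > 0, ∃ ν M f,
      IsGraphIn (interior E) (frontier E) (Metric.ball p r) ε ν M f :=
    fun ε hε0 hε1 p hp => hsmooth.exists_isGraphIn hp hε0 hε1
  have hH : Measure.euclideanHausdorffMeasure m (frontier E) < ⊤ :=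
    euclideanHausdorffMeasure_lt_top isOpen_interior hK frontier_interior_subset
      (ε := 1 / 2) (half_le_self zero_le_one) (hgraph (1 / 2) (half_pos one_pos) (half_lt_self one_pos))
  have hper : classicalPerimeter E univ = Measure.euclideanHausdorffMeasure m (frontier E) := by
    rw [classicalPerimeter, inter_univ, Nat.add_sub_cancel]
  have hnull : volume (frontier E) = 0 := by
    rw [← EuclideanSpace.euclideanHausdorffMeasure_eq_volume]
    -- Finite `m`-dimensional measure forces zero `(m + 1)`-dimensional measure, so `E` may be
    -- replaced by its interior, whichever boundary points it contains.
    exact (Measure.euclideanHausdorffMeasure_zero_or_top (Nat.lt_succ_self m) _).resolve_right hH.ne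
  have hae : interior E =ᵐ[volume] E := interior_ae_eq_of_null_frontier hnull
  rw [hper, Nat.add_sub_cancel]
  refine ⟨hH, ?_⟩
  have hfrac : ∀ s, fracPerimeter s E univ = ∫⁻ h, volume {x | x ∈ interior E ∧ x + h ∉ interior E} *
      (1 / ‖h‖ₑ ^ (((m + 1 : ℕ) : ℝ) + 2 * s)) := fun s => by
    rw [fracPerimeter_univ, ← interaction_compl_eq s isOpen_interior]
    exact interaction_congr s hae.symm (ae_eq_set_compl_compl.2 hae.symm)
  simp_rw [hfrac]
  exact tendsto_crossing isOpen_interior (hE.subset interior_subset) hK frontier_interior_subset hgraph
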